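/- Let $x_1,\dots,x_n\in\mathbb R^r$ ($r\ge 1$) be the rows of $X\in\mathbb R^{n\times r}$, let $c=\frac1n\sum_i x_i$, let $X_c$ be the matrix with rows $(x_i-c)^T$, $L^\star=X_cX_c^T$, and $D^\star=(\|x_i-x_j\|_2^2)_{i,j}$. Assume $X_c$ has full column rank and let $L^\star=U^\star\Lambda^\star(U^\star)^T$ be an eigen-decomposition with $(U^\star)^TU^\star=I_r$, $\Lambda^\star=\mathrm{diag}(\lambda_1^\star,\dots,\lambda_r^\star)$, $\lambda_1^\star\ge\dots\ge\lambda_r^\star>0$; put $\kappa=\lambda_1^\star/\lambda_r^\star$. For a matrix $M$ let $\|M\|_\infty=\max_{i,j}|M_{ij}|$ and $\|M\|_{2,\infty}=\max_i\|e_i^TM\|_2$. Assume $\|U^\star\|_{2,\infty}\le\sqrt{\mu r/n}$, and let $S^\star\in\mathbb R^{n\times n}$ be symmetric with at most $\alpha n$ nonzero entries in each row and column. Let $D=D^\star+S^\star$. For symmetric $Z$ let $\mathcal A(Z)=\mathrm{diag}(Z)\mathbf 1^T+\mathbf 1\,\mathrm{diag}(Z)^T-2Z$ (with $\mathrm{diag}(Z)\in\mathbb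 R^n$ the vector of diagonal entries), $\mathcal B(Z)=-\frac12JZJ$ with $J=I_n-\frac1n\mathbf 1\mathbf 1^T$, and $\mathcal H_r^+(Z)=\sum_{i=1}^r\max\{\lambda_i,0\}u_iu_i^T$, where $Z=\sum_{i=1}^n\lambda_iu_iu_i^T$ is an orthonormal eigen-decomposition with $\lambda_1\ge\dots\ge\lambda_n$. Let $\mathcal T_\xi$ act on each entry by $z\mapsto z$ if $|z|>\xi$ and $z\mapsto 0$ otherwise. Given $\xi^0$ and $\gamma$, put $\xi^k=\xi^0\gamma^k$, $S^0=\mathcal T_{\xi^0}(D)$, $L^1=\mathcal H_r^+\mathcal B(D-S^0)$, and for $k\ge1$ $$S^k=\mathcal T_{\xi^k}(D-\mathcal A(L^k)),\qquad L^{k+1}=\mathcal H_r^+\mathcal P_{T^k}\mathcal B(D-S^k),$$ where $L^k=U^k\Lambda^k(U^k)^T$ is an eigen-decomposition with $U^k\in\mathbb R^{n\times r}$, $(U^k)^TU^k=I_r$, $\Lambda^k$ diagonal with descending entries, and $\mathcal P_{T^k}(Z)=U^k(U^k)^TZ+ZU^k(U^k)^T-U^k(U^k)^TZU^k(U^k)^T$.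 All choices of eigen-decompositions are allowed. Suppose $\|D^\star\|_\infty\le\xi^0\le3\|D^\star\|_\infty$, $\gamma\in[\frac13,1)$ and $$\alpha\le\frac1{1624}\cdot\frac{\gamma}{\mu r\kappa^2}.$$ For $k\ge0$ let $X^{k+1}=U^{k+1}(\Lambda^{k+1})^{1/2}$ and $X^\star=U^\star(\Lambda^\star)^{1/2}$, let $(X^\star)^TX^{k+1}=Y^{k+1}\widetilde\Sigma^{k+1}(Z^{k+1})^T$ be any singular value decomposition, with $Y^{k+1},Z^{k+1}$ orthogonal $r\times r$ matrices, and let $R^{k+1}=Y^{k+1}(Z^{k+1})^T$. Then for every $k\ge0$ $$\|X^{k+1}-X^\star R^{k+1}\|_{2,\infty}\le\sqrt{\frac{\mu r\kappa\lambda_1^\star}{n}}\;\gamma^{k+1}.$$ Moreover there is an orthogonal $r\times r$ matrix $Q^\star$ with $X_c=X^\star Q^\star$ such that, for every $k\ge0$, $\|X^{k+1}-X_c(Q^\star)^TR^{k+1}\|_{2,\infty}\le\sqrt{\mu r\kappa\lambda_1^\star/n}\;\gamma^{k+1}$. -/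

import Mathlib

open scoped Matrix

noncomputable section

namespace RMDS

/-- The largest Euclidean norm of a row, `‖Z‖_{2,∞}`. -/
def twoInfNorm {n r : ℕ} (Z : Matrix (Fin n) (Fin r) ℝ) : ℝ :=
  ⨆ i : Fin n, Real.sqrt (∑ j : Fin r, Z i j ^ 2)

/-- The entrywise infinity norm, `‖M‖_∞`. -/
def entryNorm {n : ℕ} (M : Matrix (Fin n) (Fin n) ℝ) : ℝ :=
  ⨆ p : Fin n × Fin n, |M p.1 p.2|

/-- The data matrix of the points (the rows of `X`) after subtracting their mean. -/
def centered {n r : ℕ} (X : Matrix (Fin n) (Fin r) ℝ) : Matrix (Fin n) (Fin r) ℝ :=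
  Matrix.of fun i j => X i j - (∑ l : Fin n, X l j) / (n : ℝ)

/-- The squared Euclidean distance matrix of the points (the rows of `X`). -/
def edm {n r : ℕ} (X : Matrix (Fin n) (Fin r) ℝ) : Matrix (Fin n) (Fin n) ℝ :=
  Matrix.of fun i j => ∑ l : Fin r, (X i l - X j l) ^ 2

/-- The Gram matrix of the centered points. -/
def gram {n r : ℕ} (X : Matrix (Fin n) (Fin r) ℝ) : Matrix (Fin n) (Fin n) ℝ :=
  centered X * (centered X)ᵀ

/-- `𝒜(Z) = diag(Z) 1ᵀ + 1 diag(Z)ᵀ - 2 Z`. -/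
def opA {n : ℕ} (Z : Matrix (Fin n) (Fin n) ℝ) : Matrix (Fin n) (Fin n) ℝ :=
  Matrix.of fun i j => Z i i + Z j j - 2 * Z i j

/-- The centering matrix `J = I - (1/n) 1 1ᵀ`. -/
def centering (n : ℕ) : Matrix (Fin n) (Fin n) ℝ :=
  1 - (n : ℝ)⁻¹ • Matrix.of fun _ _ => (1 : ℝ)

/-- `ℬ(Z) = -(1/2) J Z J`. -/
def opB {n : ℕ} (Z : Matrix (Fin n) (Fin n) ℝ) : Matrix (Fin n) (Fin n) ℝ :=
  (-(1 / 2 : ℝ)) • (centering n * Z * centering n)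

/-- Entrywise hard thresholding `𝒯_ξ`. -/
def hardThreshold {n : ℕ} (ξ : ℝ) (Z : Matrix (Fin n) (Fin n) ℝ) :
    Matrix (Fin n) (Fin n) ℝ :=
  Matrix.of fun i j => if ξ < |Z i j| then Z i j else 0

/-- The tangent space projection determined by `U`:
`𝒫(Z) = U Uᵀ Z + Z U Uᵀ - U Uᵀ Z U Uᵀ`. -/
def tangentProj {n r : ℕ} (U : Matrix (Fin n) (Fin r) ℝ) (Z : Matrix (Fin n) (Fin n) ℝ) :
    Matrix (Fin n) (Fin n) ℝ :=
  U * Uᵀ * Z + Z * (U * Uᵀ) - U * Uᵀ * Z * (U * Uᵀ)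

/-- `L = U diag(lam) Uᵀ` is a (possibly thin) eigen-decomposition of `L`: the `m` columns of `U`
are orthonormal and `lam` is in descending order. -/
structure IsEigDecomp {n m : ℕ} (L : Matrix (Fin n) (Fin n) ℝ)
    (U : Matrix (Fin n) (Fin m) ℝ) (lam : Fin m → ℝ) : Prop where
  orthonormal : Uᵀ * U = 1
  descending : Antitone lam
  eq : L = U * Matrix.diagonal lam * Uᵀ

/-- `L` is a value of `ℋ_r⁺(Z)`: for some full eigen-decomposition of `Z`, with descending
eigenvalues `lam 0 ≥ lam 1 ≥ …` and eigenvectors the columns `u_i` of `V`,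
`L = ∑_{i < r} max (lam i) 0 • u_i u_iᵀ`. (Only ties between the `r`-th and the `(r+1)`-st
eigenvalue leave a choice; every choice is admitted.) -/
def IsTopPSD {n : ℕ} (r : ℕ) (Z L : Matrix (Fin n) (Fin n) ℝ) : Prop :=
  ∃ (V : Matrix (Fin n) (Fin n) ℝ) (lam : Fin n → ℝ), IsEigDecomp Z V lam ∧
    L = V * Matrix.diagonal (fun i : Fin n => if i.val < r then max (lam i) 0 else 0) * Vᵀ

/-- The sequences `S 0, S 1, …` and `L 1, L 2, …`, with eigen-decompositions
`L k = U k diag(lam k) (U k)ᵀ` (`k ≥ 1`, `U k` of size `n × r`), are produced by the accelerated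
alternating projections for the input matrix `D`, target rank `r`, initial threshold `ξ0` and
decay rate `γ`. The values `L 0`, `U 0`, `lam 0` play no role. -/
structure IsRun {n : ℕ} (r : ℕ) (D : Matrix (Fin n) (Fin n) ℝ) (ξ0 γ : ℝ)
    (S L : ℕ → Matrix (Fin n) (Fin n) ℝ) (U : ℕ → Matrix (Fin n) (Fin r) ℝ)
    (lam : ℕ → Fin r → ℝ) : Prop where
  init_S : S 0 = hardThreshold ξ0 D
  init_L : IsTopPSD r (opB (D - S 0)) (L 1)
  eig : ∀ k, 1 ≤ k → IsEigDecomp (L k) (U k) (lam k)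
  step_S : ∀ k, 1 ≤ k → S k = hardThreshold (ξ0 * γ ^ k) (D - opA (L k))
  step_L : ∀ k, 1 ≤ k → IsTopPSD r (tangentProj (U k) (opB (D - S k))) (L (k + 1))

/-- No row and no column has more than `α n` nonzero entries. -/
def IsSparse {n : ℕ} (α : ℝ) (S : Matrix (Fin n) (Fin n) ℝ) : Prop :=
  (∀ i, ((Finset.univ.filter fun j => S i j ≠ 0).card : ℝ) ≤ α * n) ∧
  (∀ j, ((Finset.univ.filter fun i => S i j ≠ 0).card : ℝ) ≤ α * n)

/-- The point configuration `U diag(lam)^{1/2}`. -/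
def points {n r : ℕ} (U : Matrix (Fin n) (Fin r) ℝ) (lam : Fin r → ℝ) :
    Matrix (Fin n) (Fin r) ℝ :=
  U * Matrix.diagonal fun j => Real.sqrt (lam j)

/-- `M = Y diag(σ) Zᵀ` is a singular value decomposition of the square matrix `M`
(the order of the singular values is immaterial for `Y Zᵀ`). -/
structure IsSVD {r : ℕ} (M Y : Matrix (Fin r) (Fin r) ℝ) (σ : Fin r → ℝ)
    (Z : Matrix (Fin r) (Fin r) ℝ) : Prop where
  left : Y ∈ Matrix.orthogonalGroup (Fin r) ℝ
  right : Z ∈ Matrix.orthogonalGroup (Fin r) ℝ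
  nonneg : ∀ j, 0 ≤ σ j
  eq : M = Y * Matrix.diagonal σ * Zᵀ

end RMDS

end

/-! Write `L`, `X` for the true Gram matrix and its factor, `X'` for the factor of an iterate, `Δ =
X' - X R`, `u = √(μ r / n)`, `sr = √λ_r`, `s1 = √λ_1`.

If every entry of `D⋆ - 𝒜(L^k)` is at most `ξ^k`, thresholding at `ξ^k` creates no outlier off the
support of `S⋆` and errs by at most `2 ξ^k` on it. As `ℬ(D⋆) = L`, the next eigenvalue problem sees
`L + G` with `G = ℬ(S⋆ - S^k)`. Sparsity makes `G` small in spectral norm (Schur test) and small row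
by row when applied to a matrix with small rows. Relative to `λ_r` the error is of order `ρ γ^k`,
where `ρ = 2 α n ξ0 / λ_r`.

A perturbation `W = L + F` then reaches the factors in two stages. In spectral norm, Weyl-type
estimates keep the top `r` eigenvalues of `W` near those of `L`, and a Sylvester identity bounds the
Procrustes error by `‖Δ‖ ≲ ‖F‖ / sr`. For rows, `W X' = X' Λ'` gives `Δ Λ' = F X' - X (R Δᵀ X')`, so
a row of `Δ` is controlled by a row of `X` times `‖Δ‖` plus a row of `F U'`.

The tangent projection costs an extra `-P L P = -N Nᵀ`, with `P` the complementary projection and `N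
= P Δ`; it is quadratic in the error. In return, rows of `F V` involve `G` only through `G U'`,
where `U'` comes from the previous step and already has small rows.

The loop closes because row accuracy `8 u s1 ρ γ^k` makes `𝒜(L^{k+1})` entrywise accurate to `68 u²
s1² ρ γ^k`, which the bound on `α` keeps below `ξ^{k+1}` (`IsClose.abs_sub_le`, `IsRun.isClose`). -/

namespace RMDS

set_option linter.unusedSectionVars false

/-! ### Euclidean row norms and the spectral norm -/

section Norms

open scoped Matrix.Norms.L2Operator

/-- The Euclidean norm of a vector given by its coordinates. -/
noncomputable def euclNorm {ι : Type*} [Fintype ι] (v : ι → ℝ) : ℝ :=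
  ‖(WithLp.toLp 2 v : EuclideanSpace ℝ ι)‖

variable {ι ι' κ : Type*} [Fintype ι] [Fintype ι'] [Fintype κ]
  [DecidableEq ι] [DecidableEq ι'] [DecidableEq κ]

lemma euclNorm_nonneg (v : ι → ℝ) : 0 ≤ euclNorm v := norm_nonneg _

lemma euclNorm_eq_sqrt (v : ι → ℝ) : euclNorm v = Real.sqrt (∑ i, v i ^ 2) := by
  simp [euclNorm, EuclideanSpace.norm_eq]

lemma euclNorm_sq (v : ι → ℝ) : euclNorm v ^ 2 = v ⬝ᵥ v := by
  rw [euclNorm_eq_sqrt, Real.sq_sqrt (Finset.sum_nonneg fun i _ => sq_nonneg _)]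
  simp [dotProduct, sq]

lemma dotProduct_le_euclNorm (v w : ι → ℝ) : |v ⬝ᵥ w| ≤ euclNorm v * euclNorm w := by
  have h := abs_real_inner_le_norm (WithLp.toLp 2 w : EuclideanSpace ℝ ι) (WithLp.toLp 2 v)
  rw [EuclideanSpace.inner_eq_star_dotProduct] at h
  simpa [euclNorm, mul_comm] using h

lemma euclNorm_add_le (v w : ι → ℝ) : euclNorm (v + w) ≤ euclNorm v + euclNorm w := by
  simpa [euclNorm] using norm_add_le (WithLp.toLp 2 v : EuclideanSpace ℝ ι) (WithLp.toLp 2 w)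

lemma euclNorm_sub_le (v w : ι → ℝ) : euclNorm (v - w) ≤ euclNorm v + euclNorm w := by
  simpa [euclNorm] using norm_sub_le (WithLp.toLp 2 v : EuclideanSpace ℝ ι) (WithLp.toLp 2 w)

lemma euclNorm_smul (c : ℝ) (v : ι → ℝ) : euclNorm (c • v) = |c| * euclNorm v := by
  simp [euclNorm, norm_smul]

lemma euclNorm_sum_le {β : Type*} (s : Finset β) (f : β → ι → ℝ) :
    euclNorm (∑ j ∈ s, f j) ≤ ∑ j ∈ s, euclNorm (f j) := by
  simpa [euclNorm] using norm_sum_le s fun j => (WithLp.toLp 2 (f j) : EuclideanSpace ℝ ι)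

lemma euclNorm_mulVec_le (A : Matrix ι ι' ℝ) (x : ι' → ℝ) :
    euclNorm (A *ᵥ x) ≤ ‖A‖ * euclNorm x :=
  Matrix.l2_opNorm_mulVec A (WithLp.toLp 2 x)

lemma opNorm_le_of_mulVec {A : Matrix ι ι' ℝ} {c : ℝ} (hc : 0 ≤ c)
    (h : ∀ x, euclNorm (A *ᵥ x) ≤ c * euclNorm x) : ‖A‖ ≤ c := by
  rw [Matrix.l2_opNorm_def]
  exact ContinuousLinearMap.opNorm_le_bound _ hc fun x => h x.ofLp

lemma opNorm_transpose (A : Matrix ι ι' ℝ) : ‖Aᵀ‖ = ‖A‖ := by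
  rw [← Matrix.conjTranspose_eq_transpose_of_trivial, Matrix.l2_opNorm_conjTranspose]

lemma opNorm_transpose_mul_self (A : Matrix ι ι' ℝ) : ‖Aᵀ * A‖ = ‖A‖ * ‖A‖ := by
  rw [← Matrix.conjTranspose_eq_transpose_of_trivial, Matrix.l2_opNorm_conjTranspose_mul_self]

lemma opNorm_one_le : ‖(1 : Matrix ι ι ℝ)‖ ≤ 1 :=
  opNorm_le_of_mulVec zero_le_one fun x => by simp

lemma opNorm_le_one_of_orthonormal {U : Matrix ι ι' ℝ} (h : Uᵀ * U = 1) : ‖U‖ ≤ 1 := by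
  have h1 := opNorm_transpose_mul_self U
  rw [h] at h1
  have := opNorm_one_le (ι := ι')
  nlinarith [norm_nonneg U]

lemma opNorm_le_one_of_projection {P : Matrix ι ι ℝ} (hs : Pᵀ = P) (hp : P * P = P) :
    ‖P‖ ≤ 1 := by
  have h1 := opNorm_transpose_mul_self P
  rw [hs, hp] at h1
  nlinarith [norm_nonneg P]

lemma opNorm_mul_le_of_le {A : Matrix ι ι' ℝ} {B : Matrix ι' κ ℝ} {a b : ℝ}
    (hA : ‖A‖ ≤ a) (hB : ‖B‖ ≤ b) : ‖A * B‖ ≤ a * b :=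
  (Matrix.l2_opNorm_mul A B).trans
    (mul_le_mul hA hB (norm_nonneg _) ((norm_nonneg _).trans hA))

lemma opNorm_diagonal_le {d : ι → ℝ} {c : ℝ} (hc : 0 ≤ c) (h : ∀ i, |d i| ≤ c) :
    ‖Matrix.diagonal d‖ ≤ c := by
  rw [Matrix.l2_opNorm_diagonal]
  exact (pi_norm_le_iff_of_nonneg hc).2 h

lemma dotProduct_mulVec_le (A : Matrix ι ι' ℝ) (x : ι → ℝ) (y : ι' → ℝ) :
    |x ⬝ᵥ A *ᵥ y| ≤ ‖A‖ * (euclNorm x * euclNorm y) := by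
  calc _ ≤ euclNorm x * euclNorm (A *ᵥ y) := dotProduct_le_euclNorm _ _
    _ ≤ euclNorm x * (‖A‖ * euclNorm y) :=
        mul_le_mul_of_nonneg_left (euclNorm_mulVec_le _ _) (euclNorm_nonneg _)
    _ = _ := by ring

lemma row_mul (A : Matrix ι ι' ℝ) (B : Matrix ι' κ ℝ) (i : ι) : (A * B) i = Bᵀ *ᵥ A i := by
  ext j
  simp [Matrix.mul_apply, Matrix.mulVec, dotProduct, mul_comm]

lemma euclNorm_row_mul_le (A : Matrix ι ι' ℝ) (B : Matrix ι' κ ℝ) (i : ι) :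
    euclNorm ((A * B) i) ≤ euclNorm (A i) * ‖B‖ := by
  rw [row_mul, ← opNorm_transpose B, mul_comm]
  exact euclNorm_mulVec_le _ _

lemma euclNorm_row_mul_le_of_le {A : Matrix ι ι' ℝ} {B : Matrix ι' κ ℝ} {i : ι} {a b : ℝ}
    (hA : euclNorm (A i) ≤ a) (hB : ‖B‖ ≤ b) : euclNorm ((A * B) i) ≤ a * b :=
  (euclNorm_row_mul_le A B i).trans
    (mul_le_mul hA hB (norm_nonneg _) ((euclNorm_nonneg _).trans hA))

lemma euclNorm_row_mul_le_of_sum {A : Matrix ι ι' ℝ} {B : Matrix ι' κ ℝ} {i : ι} {s m : ℝ}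
    (hm : 0 ≤ m) (hA : ∑ j, |A i j| ≤ s) (hB : ∀ j, euclNorm (B j) ≤ m) :
    euclNorm ((A * B) i) ≤ s * m := by
  have h : (A * B) i = ∑ j, A i j • B j := by
    ext k
    simp [Matrix.mul_apply]
  calc _ ≤ ∑ j, euclNorm (A i j • B j) := by rw [h]; exact euclNorm_sum_le _ _
    _ ≤ ∑ j, |A i j| * m := Finset.sum_le_sum fun j _ => by
        rw [euclNorm_smul]; exact mul_le_mul_of_nonneg_left (hB j) (abs_nonneg _)
    _ ≤ s * m := by rw [← Finset.sum_mul]; exact mul_le_mul_of_nonneg_right hA hm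

lemma abs_mul_transpose_le (A : Matrix ι κ ℝ) (B : Matrix ι' κ ℝ) (i : ι) (j : ι') :
    |(A * Bᵀ) i j| ≤ euclNorm (A i) * euclNorm (B j) :=
  dotProduct_le_euclNorm (A i) (B j)

/-- The Schur test. -/
lemma opNorm_le_of_abs_sums {E : Matrix ι ι' ℝ} {a : ℝ} (ha : 0 ≤ a)
    (hrow : ∀ i, ∑ j, |E i j| ≤ a) (hcol : ∀ j, ∑ i, |E i j| ≤ a) : ‖E‖ ≤ a := by
  refine opNorm_le_of_mulVec ha fun x => ?_
  refine abs_le_of_sq_le_sq' ?_ (mul_nonneg ha (euclNorm_nonneg _)) |>.2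
  rw [mul_pow, euclNorm_sq, euclNorm_sq]
  have hrow' : ∀ i, (E *ᵥ x) i * (E *ᵥ x) i ≤ a * ∑ j, |E i j| * (x j * x j) := fun i => by
    have h1 := Finset.sum_mul_sq_le_sq_mul_sq Finset.univ
      (fun j => Real.sqrt |E i j|) (fun j => Real.sqrt |E i j| * |x j|)
    have h2 : |(E *ᵥ x) i| ≤ ∑ j, Real.sqrt |E i j| * (Real.sqrt |E i j| * |x j|) := by
      refine (Finset.abs_sum_le_sum_abs _ _).trans (Finset.sum_le_sum fun j _ => ?_)
      rw [← mul_assoc, Real.mul_self_sqrt (abs_nonneg _), abs_mul]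
    have h3 : (E *ᵥ x) i * (E *ᵥ x) i
        ≤ (∑ j, Real.sqrt |E i j| * (Real.sqrt |E i j| * |x j|)) ^ 2 := by
      rw [← sq, ← sq_abs]
      exact pow_le_pow_left₀ (abs_nonneg _) h2 2
    refine h3.trans (h1.trans ?_)
    simp only [mul_pow, Real.sq_sqrt (abs_nonneg _), sq_abs]
    simp only [← sq]
    exact mul_le_mul_of_nonneg_right (hrow i)
      (Finset.sum_nonneg fun j _ => mul_nonneg (abs_nonneg _) (sq_nonneg _))
  calc (E *ᵥ x) ⬝ᵥ (E *ᵥ x) ≤ ∑ i, a * ∑ j, |E i j| * (x j * x j) :=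
        Finset.sum_le_sum fun i _ => hrow' i
    _ = a * ∑ j, (∑ i, |E i j|) * (x j * x j) := by
        rw [← Finset.mul_sum, Finset.sum_comm]
        simp only [Finset.sum_mul]
    _ ≤ a * ∑ j, a * (x j * x j) := mul_le_mul_of_nonneg_left
        (Finset.sum_le_sum fun j _ =>
          mul_le_mul_of_nonneg_right (hcol j) (mul_self_nonneg _)) ha
    _ = a ^ 2 * (x ⬝ᵥ x) := by rw [← Finset.mul_sum, dotProduct]; ring

lemma twoInfNorm_le {n r : ℕ} {Z : Matrix (Fin n) (Fin r) ℝ} {c : ℝ} (hc : 0 ≤ c)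
    (h : ∀ i, euclNorm (Z i) ≤ c) : twoInfNorm Z ≤ c :=
  Real.iSup_le (fun i => (euclNorm_eq_sqrt (Z i)).symm.trans_le (h i)) hc

lemma euclNorm_le_twoInfNorm {n r : ℕ} (Z : Matrix (Fin n) (Fin r) ℝ) (i : Fin n) :
    euclNorm (Z i) ≤ twoInfNorm Z := by
  rw [euclNorm_eq_sqrt]
  exact le_ciSup (f := fun i => Real.sqrt (∑ j : Fin r, Z i j ^ 2))
    (Set.finite_range _).bddAbove i

lemma exists_mulVec_eq_zero_of_card_lt (A : Matrix ι ι' ℝ)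
    (h : Fintype.card ι < Fintype.card ι') : ∃ y, y ≠ 0 ∧ A *ᵥ y = 0 := by
  have h1 := LinearMap.ker_ne_bot_of_finrank_lt (f := A.mulVecLin) (by simpa using h)
  obtain ⟨y, hy, hy0⟩ := Submodule.exists_mem_ne_zero_of_ne_bot h1
  exact ⟨y, hy0, by simpa using hy⟩

lemma euclNorm_pos {v : ι → ℝ} (hv : v ≠ 0) : 0 < euclNorm v :=
  norm_pos_iff.2 fun h => hv (by simpa using congrArg WithLp.ofLp h)

lemma euclNorm_mulVec_of_orthonormal {U : Matrix ι ι' ℝ} (h : Uᵀ * U = 1) (y : ι' → ℝ) :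
    euclNorm (U *ᵥ y) = euclNorm y := by
  rw [← sq_eq_sq₀ (euclNorm_nonneg _) (euclNorm_nonneg _), euclNorm_sq, euclNorm_sq,
    Matrix.dotProduct_mulVec, ← Matrix.mulVec_transpose, Matrix.mulVec_mulVec, h,
    Matrix.one_mulVec]

end Norms

/-! ### Weyl-type eigenvalue bounds and the Procrustes estimate -/

section Spectral

open scoped Matrix.Norms.L2Operator

variable {n m r : ℕ}

lemma dotProduct_eigDecomp_mulVec (U : Matrix (Fin n) (Fin m) ℝ) (d : Fin m → ℝ)
    (x : Fin n → ℝ) :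
    x ⬝ᵥ (U * Matrix.diagonal d * Uᵀ) *ᵥ x = ∑ j, d j * ((Uᵀ *ᵥ x) j) ^ 2 := by
  rw [← Matrix.mulVec_mulVec, ← Matrix.mulVec_mulVec, Matrix.dotProduct_mulVec,
    ← Matrix.mulVec_transpose]
  simp only [dotProduct, Matrix.mulVec_diagonal]
  exact Finset.sum_congr rfl fun j _ => by ring

lemma euclNorm_sq_eq_sum {ι : Type*} [Fintype ι] [DecidableEq ι] (v : ι → ℝ) :
    euclNorm v ^ 2 = ∑ i, v i ^ 2 := by
  rw [euclNorm_sq]; simp [dotProduct, sq]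

lemma dotProduct_eigDecomp_nonneg {L : Matrix (Fin n) (Fin n) ℝ} {U : Matrix (Fin n) (Fin m) ℝ}
    {d : Fin m → ℝ} (h : IsEigDecomp L U d) (hd : ∀ j, 0 ≤ d j) (x : Fin n → ℝ) :
    0 ≤ x ⬝ᵥ L *ᵥ x := by
  rw [h.eq, dotProduct_eigDecomp_mulVec]
  exact Finset.sum_nonneg fun j _ => mul_nonneg (hd j) (sq_nonneg _)

lemma neg_opNorm_le_eigenvalue {W L : Matrix (Fin n) (Fin n) ℝ} {V : Matrix (Fin n) (Fin m) ℝ}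
    {d : Fin m → ℝ} (h : IsEigDecomp W V d) (hL : ∀ x, 0 ≤ x ⬝ᵥ L *ᵥ x) (i : Fin m) :
    -‖W - L‖ ≤ d i := by
  set y : Fin m → ℝ := Pi.single i 1
  have hy : V.transpose *ᵥ (V *ᵥ y) = y := by
    rw [Matrix.mulVec_mulVec, h.orthonormal, Matrix.one_mulVec]
  have hn : euclNorm (V *ᵥ y) = 1 := by
    rw [euclNorm_mulVec_of_orthonormal h.orthonormal]
    simp [euclNorm, y]
  have h1 := dotProduct_eigDecomp_mulVec V d (V *ᵥ y)
  rw [← h.eq, hy] at h1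
  have h2 : ∑ j, d j * y j ^ 2 = d i := by
    rw [Finset.sum_eq_single i] <;> simp +contextual [y]
  have h3 := dotProduct_mulVec_le (W - L) (V *ᵥ y) (V *ᵥ y)
  rw [Matrix.sub_mulVec, dotProduct_sub, h1, h2, hn] at h3
  have := hL (V *ᵥ y)
  have := (abs_le.1 h3).1
  linarith

/-- Courant–Fischer by counting dimensions: among combinations of the first `r + 1` eigenvectors of
`W`, some nonzero one is orthogonal to the `r` columns of `U`. There the form of `L` vanishes while
that of `W` is at least `d i` times the squared norm. -/
lemma eigenvalue_le_opNorm {W L : Matrix (Fin n) (Fin n) ℝ} {V : Matrix (Fin n) (Fin n) ℝ}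
    {d : Fin n → ℝ} (h : IsEigDecomp W V d) {U : Matrix (Fin n) (Fin r) ℝ} {l : Fin r → ℝ}
    (hL : IsEigDecomp L U l) (i : Fin n) (hi : r ≤ i.val) : d i ≤ ‖W - L‖ := by
  have hle : r + 1 ≤ n := by have := i.isLt; omega
  set V' := V.submatrix id (Fin.castLE hle) with hV'
  obtain ⟨y, hy0, hy⟩ := exists_mulVec_eq_zero_of_card_lt (Uᵀ * V') (by simp)
  have hVV : Vᵀ * V' = (1 : Matrix (Fin n) (Fin n) ℝ).submatrix id (Fin.castLE hle) := by
    rw [← h.orthonormal]; ext a b; simp [hV', Matrix.mul_apply]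
  have hV'o : V'ᵀ * V' = 1 := by
    ext a b
    have h1 := congrFun (congrFun hVV (Fin.castLE hle a)) b
    simpa [hV', Matrix.mul_apply, Matrix.one_apply] using h1
  have hn := euclNorm_mulVec_of_orthonormal hV'o y
  have h1 := dotProduct_eigDecomp_mulVec V d (V' *ᵥ y)
  have h2 := dotProduct_eigDecomp_mulVec U l (V' *ᵥ y)
  rw [← hL.eq, Matrix.mulVec_mulVec y Uᵀ, hy] at h2
  rw [← h.eq, Matrix.mulVec_mulVec y Vᵀ] at h1
  have h3 := dotProduct_mulVec_le (W - L) (V' *ᵥ y) (V' *ᵥ y)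
  rw [Matrix.sub_mulVec, dotProduct_sub, h1, h2, hn] at h3
  have hz : ∀ j : Fin n, r < j.val → ((Vᵀ * V') *ᵥ y) j = 0 := fun j hj => by
    rw [hVV]
    simp only [Matrix.mulVec, dotProduct, Matrix.submatrix_apply]
    refine Finset.sum_eq_zero fun k _ => ?_
    rw [Matrix.one_apply_ne, zero_mul]
    intro hjk
    have := congrArg Fin.val hjk
    have := k.isLt
    simp at *
    omega
  have hnz : ∑ j, ((Vᵀ * V') *ᵥ y) j ^ 2 = euclNorm y ^ 2 := by
    rw [← euclNorm_sq_eq_sum, ← Matrix.mulVec_mulVec, ← hn]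
    have hVt : Vᵀᵀ * Vᵀ = 1 := by
      rw [Matrix.transpose_transpose]; exact mul_eq_one_comm.1 h.orthonormal
    rw [euclNorm_mulVec_of_orthonormal hVt]
  have h4 : d i * euclNorm y ^ 2 ≤ ∑ j, d j * ((Vᵀ * V') *ᵥ y) j ^ 2 := by
    rw [← hnz, Finset.mul_sum]
    refine Finset.sum_le_sum fun j _ => ?_
    by_cases hj : r < j.val
    · rw [hz j hj]; simp
    · exact mul_le_mul_of_nonneg_right
        (h.descending (by rw [Fin.le_def]; omega)) (sq_nonneg _)
  have h5 := (abs_le.1 h3).2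
  simp only [Pi.zero_apply, ne_eq, OfNat.ofNat_ne_zero, not_false_eq_true, zero_pow, mul_zero,
    Finset.sum_const_zero, sub_zero] at h5
  have h6 := euclNorm_pos hy0
  refine le_of_mul_le_mul_right ?_ (pow_pos h6 2)
  calc _ ≤ _ := h4.trans h5
    _ = _ := by ring

/-- As `L` is positive semidefinite of rank at most `r`, whatever truncation discards (negative
eigenvalues and those of index at least `r`) has modulus at most `‖W - L‖`. Ties at the cut play no
role. -/
lemma opNorm_topPSD_sub_le {W L L' : Matrix (Fin n) (Fin n) ℝ} {U : Matrix (Fin n) (Fin r) ℝ}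
    {l : Fin r → ℝ} (hL : IsEigDecomp L U l) (hl : ∀ j, 0 ≤ l j) (h : IsTopPSD r W L') :
    ‖L' - W‖ ≤ ‖W - L‖ := by
  obtain ⟨V, d, hV, rfl⟩ := h
  conv_lhs => rw [hV.eq]
  rw [← Matrix.sub_mul, ← Matrix.mul_sub, Matrix.diagonal_sub]
  have h1 := opNorm_le_one_of_orthonormal hV.orthonormal
  have h2 : ‖Vᵀ‖ ≤ 1 := by rwa [opNorm_transpose]
  have h3 : ‖Matrix.diagonal fun i : Fin n => (if i.val < r then max (d i) 0 else 0) - d i‖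
      ≤ ‖W - L‖ := by
    refine opNorm_diagonal_le (norm_nonneg _) fun i => ?_
    have h4 := neg_opNorm_le_eigenvalue hV (dotProduct_eigDecomp_nonneg hL hl) i
    have h5 := norm_nonneg (W - L)
    split_ifs with hi
    · rcases le_total (d i) 0 with h0 | h0
      · rw [max_eq_right h0, abs_le]; constructor <;> linarith
      · rw [max_eq_left h0]; simp
    · have h6 := eigenvalue_le_opNorm hV hL i (not_lt.1 hi)
      rw [abs_le]; constructor <;> linarith
  simpa using opNorm_mul_le_of_le (opNorm_mul_le_of_le h1 h3) h2

lemma opNorm_topPSD_sub_le_two_mul {W L L' : Matrix (Fin n) (Fin n) ℝ}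
    {U : Matrix (Fin n) (Fin r) ℝ} {l : Fin r → ℝ} (hL : IsEigDecomp L U l)
    (hl : ∀ j, 0 ≤ l j) (h : IsTopPSD r W L') : ‖L' - L‖ ≤ 2 * ‖W - L‖ := by
  have h1 := opNorm_topPSD_sub_le hL hl h
  have h2 := norm_add_le (L' - W) (W - L)
  rw [sub_add_sub_cancel] at h2
  linarith

/-- This relation does not mention the eigenvectors `V` behind the truncation, so it can be used
with any other eigen-decomposition of `L`. -/
lemma mul_topPSD {W L : Matrix (Fin n) (Fin n) ℝ} (h : IsTopPSD r W L) : W * L = L * L := by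
  obtain ⟨V, d, hV, rfl⟩ := h
  have key : ∀ a b : Fin n → ℝ, V * Matrix.diagonal a * Vᵀ * (V * Matrix.diagonal b * Vᵀ)
      = V * Matrix.diagonal (a * b) * Vᵀ := fun a b => by
    calc _ = V * Matrix.diagonal a * (Vᵀ * V) * Matrix.diagonal b * Vᵀ := by
          simp only [Matrix.mul_assoc]
      _ = _ := by
          rw [hV.orthonormal, Matrix.mul_one, Matrix.mul_assoc V, Matrix.diagonal_mul_diagonal']
          rfl
  conv_lhs => rw [hV.eq]
  rw [key, key]
  congr 3
  ext i
  simp only [Pi.mul_apply]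
  split_ifs
  · rcases le_total (d i) 0 with h0 | h0 <;> simp [h0]
  · simp

/-- No ordering of `l'` is needed: `r - 1` linear conditions on `r` unknowns leave a `y ≠ 0` for
which `U'ᵀ U y` lives on coordinate `j` alone, so the form of `L'` at `U y` only sees `l' j`. -/
lemma sub_opNorm_le_eigenvalue {L L' : Matrix (Fin n) (Fin n) ℝ} {U U' : Matrix (Fin n) (Fin r) ℝ}
    {l l' : Fin r → ℝ} (hL : IsEigDecomp L U l) (hL' : IsEigDecomp L' U' l') {c : ℝ}
    (hc : ∀ j, c ≤ l j) (hlt : ‖L' - L‖ < c) (j : Fin r) : c - ‖L' - L‖ ≤ l' j := by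
  obtain ⟨y, hy0, hy⟩ := exists_mulVec_eq_zero_of_card_lt
    ((U'ᵀ * U).submatrix (Subtype.val : {i // i ≠ j} → Fin r) id) (by
      rw [Fintype.card_subtype_compl]; simpa using Fin.pos j)
  have hz : ∀ i, i ≠ j → ((U'ᵀ * U) *ᵥ y) i = 0 := fun i hi => congrFun hy ⟨i, hi⟩
  have hn := euclNorm_mulVec_of_orthonormal hL.orthonormal y
  have h1 := dotProduct_eigDecomp_mulVec U l (U *ᵥ y)
  rw [← hL.eq, Matrix.mulVec_mulVec y Uᵀ, hL.orthonormal, Matrix.one_mulVec] at h1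
  have h2 := dotProduct_eigDecomp_mulVec U' l' (U *ᵥ y)
  rw [← hL'.eq, Matrix.mulVec_mulVec y U'ᵀ, Finset.sum_eq_single j
    (fun i _ hi => by rw [hz i hi]; simp) (by simp)] at h2
  have h3 := dotProduct_mulVec_le (L' - L) (U *ᵥ y) (U *ᵥ y)
  rw [Matrix.sub_mulVec, dotProduct_sub, h1, h2, hn] at h3
  have h4 := (abs_le.1 h3).1
  have h5 : c * euclNorm y ^ 2 ≤ ∑ j, l j * y j ^ 2 := by
    rw [euclNorm_sq_eq_sum, Finset.mul_sum]
    exact Finset.sum_le_sum fun i _ => mul_le_mul_of_nonneg_right (hc i) (sq_nonneg _)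
  have h6 := euclNorm_pos hy0
  have h7 : ((U'ᵀ * U) *ᵥ y) j ^ 2 ≤ euclNorm y ^ 2 := by
    have h8 : ((U'ᵀ * U) *ᵥ y) j ^ 2 ≤ euclNorm ((U'ᵀ * U) *ᵥ y) ^ 2 := by
      rw [euclNorm_sq_eq_sum]
      exact Finset.single_le_sum (f := fun i => ((U'ᵀ * U) *ᵥ y) i ^ 2)
        (fun i _ => sq_nonneg _) (Finset.mem_univ j)
    refine h8.trans (pow_le_pow_left₀ (euclNorm_nonneg _) ?_ 2)
    refine (euclNorm_mulVec_le _ _).trans ?_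
    have h9 := opNorm_mul_le_of_le (A := U'ᵀ) (B := U) (a := 1) (b := 1)
      (by rw [opNorm_transpose]; exact opNorm_le_one_of_orthonormal hL'.orthonormal)
      (opNorm_le_one_of_orthonormal hL.orthonormal)
    nlinarith
  have h8 : (c - ‖L' - L‖) * euclNorm y ^ 2 ≤ l' j * ((U'ᵀ * U) *ᵥ y) j ^ 2 := by nlinarith
  have h9 : 0 < (c - ‖L' - L‖) * euclNorm y ^ 2 := mul_pos (by linarith) (by positivity)
  -- The sign must be known before the squared coordinate can be replaced by the larger `‖y‖²`.
  have h10 : 0 < l' j := by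
    by_contra hneg
    have := mul_nonpos_of_nonpos_of_nonneg (not_lt.1 hneg) (sq_nonneg (((U'ᵀ * U) *ᵥ y) j))
    linarith
  refine le_of_mul_le_mul_right (h8.trans ?_) (pow_pos h6 2)
  exact mul_le_mul_of_nonneg_left h7 h10.le

/-- A spectral-norm bound for the orthogonal Procrustes problem. -/
lemma opNorm_sub_le_of_procrustes {X Y : Matrix (Fin n) (Fin r) ℝ} (hsymm : (Yᵀ * X)ᵀ = Yᵀ * X)
    (hpsd : ∀ v, 0 ≤ v ⬝ᵥ (Yᵀ * X) *ᵥ v) {s g : ℝ} (hs : 0 < s) (hg : ‖X * Xᵀ - Y * Yᵀ‖ ≤ g)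
    (hlow : ∀ v, s ^ 2 * (v ⬝ᵥ v) ≤ v ⬝ᵥ (Xᵀ * X + Yᵀ * Y) *ᵥ v) :
    ‖X - Y‖ ≤ 2 * g / s := by
  have hg0 : 0 ≤ g := (norm_nonneg _).trans hg
  set Δ := X - Y with hΔ
  set S := X + Y with hS
  set G := X * Xᵀ - Y * Yᵀ with hG
  have hXY : Xᵀ * Y = Yᵀ * X := by
    rw [← hsymm, Matrix.transpose_mul, Matrix.transpose_transpose]
  -- The symmetry of `Yᵀ X` turns the difference of Gram matrices into a Sylvester equation for `Δ`.
  have hsyl : S * Sᵀ * Δ + Δ * (Sᵀ * S) = 2 • (G * S) := by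
    have h1 : Sᵀ * Δ = Xᵀ * X - Yᵀ * Y := by
      rw [hS, hΔ, Matrix.transpose_add, Matrix.add_mul, Matrix.mul_sub, Matrix.mul_sub, hXY]
      abel
    have h2 : Δᵀ * S = Xᵀ * X - Yᵀ * Y := by
      rw [hS, hΔ, Matrix.transpose_sub, Matrix.sub_mul, Matrix.mul_add, Matrix.mul_add, hXY]
      abel
    have h3 : Δ * Sᵀ + S * Δᵀ = 2 • G := by
      rw [hS, hΔ, hG, Matrix.transpose_add, Matrix.transpose_sub]
      simp only [Matrix.sub_mul, Matrix.mul_add, Matrix.add_mul, Matrix.mul_sub, two_smul]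
      abel
    rw [Matrix.mul_assoc, h1, ← h2, ← Matrix.mul_assoc, ← Matrix.mul_assoc, ← Matrix.add_mul,
      add_comm, h3, Matrix.smul_mul]
  have hH : (Δᵀ * Δ).IsHermitian := by
    simpa using Matrix.isHermitian_conjTranspose_mul_self Δ
  -- Pairing the Sylvester equation at a right singular vector `v` with `w = Δ v` gives `‖Sᵀ w‖² +
  -- ‖w‖² ‖S v‖² = 2 w ⬝ G S v`. Dropping the first term and cancelling leaves `‖w‖ ‖S v‖ ≤ 2 g`.
  have heig : ∀ i, hH.eigenvalues i ≤ (2 * g / s) ^ 2 := fun i => by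
    set d := hH.eigenvalues i
    set v : Fin r → ℝ := (hH.eigenvectorBasis i).ofLp with hv
    have hvv : v ⬝ᵥ v = 1 := by
      rw [← euclNorm_sq]
      have : euclNorm v = 1 := hH.eigenvectorBasis.norm_eq_one i
      rw [this]; norm_num
    have hev : (Δᵀ * Δ) *ᵥ v = d • v := hH.mulVec_eigenvectorBasis i
    set w := Δ *ᵥ v with hw
    have hww : w ⬝ᵥ w = d := by
      rw [hw, Matrix.dotProduct_mulVec, ← Matrix.mulVec_transpose, Matrix.mulVec_mulVec, hev]
      simp [hvv]
    have hd : 0 ≤ d := by rw [← hww, ← euclNorm_sq]; positivity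
    have h1 : w ⬝ᵥ (S * Sᵀ * Δ) *ᵥ v = euclNorm (Sᵀ *ᵥ w) ^ 2 := by
      rw [← Matrix.mulVec_mulVec, ← Matrix.mulVec_mulVec, Matrix.dotProduct_mulVec,
        ← Matrix.mulVec_transpose, euclNorm_sq]
    have h2 : w ⬝ᵥ (Δ * (Sᵀ * S)) *ᵥ v = d * euclNorm (S *ᵥ v) ^ 2 := by
      rw [← Matrix.mulVec_mulVec, Matrix.dotProduct_mulVec, ← Matrix.mulVec_transpose, hw,
        Matrix.mulVec_mulVec, hev, smul_dotProduct, ← Matrix.mulVec_mulVec,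
        Matrix.dotProduct_mulVec, ← Matrix.mulVec_transpose, Matrix.transpose_transpose,
        euclNorm_sq, smul_eq_mul]
    have h3 := congrArg (fun M => w ⬝ᵥ M *ᵥ v) hsyl
    simp only [Matrix.add_mulVec, dotProduct_add, h1, h2, two_smul] at h3
    have h4 := dotProduct_mulVec_le G w (S *ᵥ v)
    rw [Matrix.mulVec_mulVec] at h4
    have h5 := (abs_le.1 h4).2
    have hwd : euclNorm w ^ 2 = d := by rw [euclNorm_sq, hww]
    -- Positivity of `Yᵀ X` makes the cross term in `‖(X + Y) v‖²` nonnegative.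
    have hSv : s ≤ euclNorm (S *ᵥ v) := by
      refine abs_le_of_sq_le_sq' ?_ (euclNorm_nonneg _) |>.2
      have h6 := hlow v
      have h7 := hpsd v
      have h8 : euclNorm (S *ᵥ v) ^ 2
          = v ⬝ᵥ (Xᵀ * X + Yᵀ * Y) *ᵥ v + 2 * (v ⬝ᵥ (Yᵀ * X) *ᵥ v) := by
        rw [euclNorm_sq, Matrix.dotProduct_mulVec, ← Matrix.mulVec_transpose,
          Matrix.mulVec_mulVec, dotProduct_comm]
        have h9 : Sᵀ * S = (Xᵀ * X + Yᵀ * Y) + (2 : ℝ) • (Yᵀ * X) := by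
          rw [hS, Matrix.transpose_add, Matrix.add_mul, Matrix.mul_add, Matrix.mul_add, hXY,
            two_smul]
          abel
        rw [h9, Matrix.add_mulVec, Matrix.smul_mulVec, dotProduct_add, dotProduct_smul,
          smul_eq_mul]
      rw [hvv] at h6
      nlinarith
    have hd' : Real.sqrt d = euclNorm w := by rw [← hwd, Real.sqrt_sq (euclNorm_nonneg _)]
    have h10 : euclNorm w * s ≤ 2 * g := by
      set p := euclNorm w with hp
      set q := euclNorm (S *ᵥ v) with hq
      have hp0 : 0 ≤ p := euclNorm_nonneg _
      have hq0 : 0 < q := hs.trans_le hSv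
      rcases hp0.eq_or_lt with h0 | h0
      · rw [← h0]; linarith
      have h11 : p * (p * q) * q ≤ 2 * g * (p * q) := by
        rw [← hwd] at h3
        nlinarith [sq_nonneg (euclNorm (Sᵀ *ᵥ w)), mul_le_mul_of_nonneg_right hg
          (mul_nonneg hp0 hq0.le)]
      have h12 : p * q ≤ 2 * g := by
        refine le_of_mul_le_mul_right ?_ (mul_pos h0 hq0)
        linarith
      exact (mul_le_mul_of_nonneg_left hSv hp0).trans h12
    rw [← hwd]
    exact pow_le_pow_left₀ (euclNorm_nonneg _) ((le_div_iff₀ hs).2 h10) 2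
  have hc : 0 ≤ 2 * g / s := by positivity
  have hnorm : ‖Δᵀ * Δ‖ ≤ (2 * g / s) ^ 2 := by
    rw [hH.spectral_theorem, Unitary.conjStarAlgAut_apply]
    have hU : ((hH.eigenvectorUnitary : Matrix (Fin r) (Fin r) ℝ))ᵀ
        * (hH.eigenvectorUnitary : Matrix (Fin r) (Fin r) ℝ) = 1 :=
      Unitary.coe_star_mul_self hH.eigenvectorUnitary
    have h1 := opNorm_le_one_of_orthonormal hU
    have h2 : ‖(star (hH.eigenvectorUnitary : Matrix (Fin r) (Fin r) ℝ))‖ ≤ 1 := by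
      rw [norm_star]; exact h1
    have h3 : ‖Matrix.diagonal (RCLike.ofReal ∘ hH.eigenvalues : Fin r → ℝ)‖
        ≤ (2 * g / s) ^ 2 := by
      refine opNorm_diagonal_le (by positivity) fun i => ?_
      simp only [Function.comp_apply, RCLike.ofReal_real_eq_id, id]
      rw [abs_of_nonneg]
      · exact heig i
      · exact (Matrix.posSemidef_conjTranspose_mul_self Δ).eigenvalues_nonneg i
    simpa using opNorm_mul_le_of_le (opNorm_mul_le_of_le h1 h3) h2
  rw [opNorm_transpose_mul_self] at hnorm
  exact abs_le_of_sq_le_sq' (by rwa [← sq] at hnorm) hc |>.2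

end Spectral

/-! ### From a perturbed eigenvalue equation to the rows of the factors -/

section Perturbation

open scoped Matrix.Norms.L2Operator

variable {n r : ℕ}

/-- For injective `H`, diagonalising `Hᵀ H` gives `Z` and the positive `σ²`; then `H Z σ⁻¹` is
orthogonal. -/
lemma exists_isSVD {H : Matrix (Fin r) (Fin r) ℝ} (hinj : ∀ y, H *ᵥ y = 0 → y = 0) :
    ∃ (Y : Matrix (Fin r) (Fin r) ℝ) (σ : Fin r → ℝ) (Z : Matrix (Fin r) (Fin r) ℝ),
      IsSVD H Y σ Z := by
  have hpd : (Hᵀ * H).PosDef := by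
    have h := Matrix.PosDef.conjTranspose_mul_self H (by
      intro x y hxy
      have h1 := hinj (x - y) (by rw [Matrix.mulVec_sub, sub_eq_zero]; exact hxy)
      exact sub_eq_zero.1 h1)
    simpa using h
  have hH := hpd.isHermitian
  set d := hH.eigenvalues with hd
  have hdpos : ∀ i, 0 < d i := fun i => hpd.eigenvalues_pos i
  set Z := (hH.eigenvectorUnitary : Matrix (Fin r) (Fin r) ℝ) with hZ
  have hZZ : Zᵀ * Z = 1 := Unitary.coe_star_mul_self hH.eigenvectorUnitary
  have hZZ' : Z * Zᵀ = 1 := mul_eq_one_comm.1 hZZ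
  have hspec : Hᵀ * H = Z * Matrix.diagonal d * Zᵀ := by
    conv_lhs => rw [hH.spectral_theorem, Unitary.conjStarAlgAut_apply]
    rfl
  set D : Matrix (Fin r) (Fin r) ℝ := Matrix.diagonal fun i => Real.sqrt (d i) with hD
  set Di : Matrix (Fin r) (Fin r) ℝ := Matrix.diagonal fun i => (Real.sqrt (d i))⁻¹ with hDi
  have hs : ∀ i, Real.sqrt (d i) ≠ 0 := fun i => (Real.sqrt_pos.2 (hdpos i)).ne'
  have h1 : Di * D = 1 := by
    rw [hD, hDi, Matrix.diagonal_mul_diagonal, ← Matrix.diagonal_one]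
    congr 1; ext i; exact inv_mul_cancel₀ (hs i)
  have h2 : Di * Matrix.diagonal d * Di = 1 := by
    rw [hDi, Matrix.diagonal_mul_diagonal, Matrix.diagonal_mul_diagonal, ← Matrix.diagonal_one]
    congr 1; ext i
    have := Real.mul_self_sqrt (hdpos i).le
    have := hs i
    field_simp
    linarith
  refine ⟨H * Z * Di, fun i => Real.sqrt (d i), Z, ?_, ?_, fun i => Real.sqrt_nonneg _, ?_⟩
  · rw [Matrix.mem_orthogonalGroup_iff']
    have hDt : Diᵀ = Di := Matrix.diagonal_transpose _
    rw [Matrix.transpose_mul, Matrix.transpose_mul, hDt]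
    calc Di * (Zᵀ * Hᵀ) * (H * Z * Di) = Di * (Zᵀ * (Hᵀ * H) * Z) * Di := by
          simp only [Matrix.mul_assoc]
      _ = Di * ((Zᵀ * Z) * Matrix.diagonal d * (Zᵀ * Z)) * Di := by
          rw [hspec]; simp only [Matrix.mul_assoc]
      _ = 1 := by rw [hZZ, Matrix.one_mul, Matrix.mul_one, h2]
  · exact hH.eigenvectorUnitary.2
  · rw [← hD]
    calc H = H * (Z * Zᵀ) := by rw [hZZ', Matrix.mul_one]
      _ = H * Z * (Di * D) * Zᵀ := by rw [h1, Matrix.mul_one, Matrix.mul_assoc]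
      _ = _ := by simp only [Matrix.mul_assoc]

lemma orthogonal_transpose_mul {R : Matrix (Fin r) (Fin r) ℝ}
    (h : R ∈ Matrix.orthogonalGroup (Fin r) ℝ) : Rᵀ * R = 1 :=
  (Matrix.mem_orthogonalGroup_iff' (Fin r) ℝ).1 h

lemma IsSVD.rotation_mem {M Y Z : Matrix (Fin r) (Fin r) ℝ} {σ : Fin r → ℝ}
    (h : IsSVD M Y σ Z) : Y * Zᵀ ∈ Matrix.orthogonalGroup (Fin r) ℝ :=
  mul_mem h.left (Unitary.star_mem h.right)

lemma points_mul_transpose {L : Matrix (Fin n) (Fin n) ℝ} {U : Matrix (Fin n) (Fin r) ℝ}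
    {l : Fin r → ℝ} (h : IsEigDecomp L U l) (hl : ∀ j, 0 ≤ l j) :
    points U l * (points U l)ᵀ = L := by
  rw [h.eq, points, Matrix.transpose_mul, Matrix.diagonal_transpose, Matrix.mul_assoc,
    ← Matrix.mul_assoc (Matrix.diagonal _), Matrix.diagonal_mul_diagonal, Matrix.mul_assoc]
  simp only [Real.mul_self_sqrt (hl _)]

lemma transpose_mul_points {L : Matrix (Fin n) (Fin n) ℝ} {U : Matrix (Fin n) (Fin r) ℝ}
    {l : Fin r → ℝ} (h : IsEigDecomp L U l) (hl : ∀ j, 0 ≤ l j) :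
    (points U l)ᵀ * points U l = Matrix.diagonal l := by
  rw [points, Matrix.transpose_mul, Matrix.diagonal_transpose, Matrix.mul_assoc,
    ← Matrix.mul_assoc Uᵀ, h.orthonormal, Matrix.one_mul, Matrix.diagonal_mul_diagonal]
  simp only [Real.mul_self_sqrt (hl _)]

lemma diagonal_mul_diagonal_inv {l : Fin r → ℝ} (hl : ∀ j, 0 < l j) :
    Matrix.diagonal l * Matrix.diagonal (fun j => (l j)⁻¹) = 1 := by
  rw [Matrix.diagonal_mul_diagonal, ← Matrix.diagonal_one]
  congr 1; ext i; exact mul_inv_cancel₀ (hl i).ne'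

lemma opNorm_diagonal_inv_le {l : Fin r → ℝ} {c : ℝ} (hc : 0 < c) (hl : ∀ j, c ≤ l j) :
    ‖Matrix.diagonal fun j => (l j)⁻¹‖ ≤ c⁻¹ :=
  opNorm_diagonal_le (inv_nonneg.2 hc.le) fun j => by
    rw [abs_of_nonneg (inv_nonneg.2 (hc.le.trans (hl j)))]
    exact inv_anti₀ hc (hl j)

/-- The decomposition of `L` may differ from the one used in the truncation. Positivity of `l` lets
one cancel `diag(l)` in `W L U = L L U`. -/
lemma mul_eigenvectors {W L : Matrix (Fin n) (Fin n) ℝ} {U : Matrix (Fin n) (Fin r) ℝ}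
    {l : Fin r → ℝ} (h : IsTopPSD r W L) (hL : IsEigDecomp L U l) (hl : ∀ j, 0 < l j) :
    W * U = U * Matrix.diagonal l := by
  have hLU : L * U = U * Matrix.diagonal l := by
    rw [hL.eq, Matrix.mul_assoc, hL.orthonormal, Matrix.mul_one]
  have h1 := mul_topPSD h
  have h2 : W * U * Matrix.diagonal l = U * Matrix.diagonal l * Matrix.diagonal l := by
    rw [Matrix.mul_assoc, ← hLU, ← Matrix.mul_assoc, h1, Matrix.mul_assoc, hLU,
      ← Matrix.mul_assoc, hLU]
  have h3 := diagonal_mul_diagonal_inv hl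
  calc W * U = W * U * (Matrix.diagonal l * Matrix.diagonal (fun j => (l j)⁻¹)) := by
        rw [h3, Matrix.mul_one]
    _ = _ := by
        rw [← Matrix.mul_assoc, h2, Matrix.mul_assoc (U * _), h3, Matrix.mul_one]

/-- Since `L = U Uᵀ L`, the equation `U' Λ' = L U' + F U'` presents `U'` as `U` times a matrix of
norm at most `1 + f / c`, plus `F U' Λ'⁻¹`. -/
lemma euclNorm_row_eigenvectors_le {W L L' : Matrix (Fin n) (Fin n) ℝ}
    {U U' : Matrix (Fin n) (Fin r) ℝ} {l l' : Fin r → ℝ} (hL : IsEigDecomp L U l)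
    (hL' : IsEigDecomp L' U' l') (htop : IsTopPSD r W L') {c f u q : ℝ} (hc : 0 < c)
    (hl' : ∀ j, c ≤ l' j) (hf : ‖W - L‖ ≤ f) {i : Fin n} (hu : euclNorm (U i) ≤ u)
    (hq : euclNorm (((W - L) * U') i) ≤ q) :
    euclNorm (U' i) ≤ u * (1 + f / c) + q / c := by
  have hpos : ∀ j, 0 < l' j := fun j => hc.trans_le (hl' j)
  set F := W - L with hF
  set D := Matrix.diagonal fun j => (l' j)⁻¹ with hD
  have hWU := mul_eigenvectors htop hL' hpos
  have hLL : U * Uᵀ * L = L := by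
    rw [hL.eq]
    calc U * Uᵀ * (U * Matrix.diagonal l * Uᵀ) = U * (Uᵀ * U) * Matrix.diagonal l * Uᵀ := by
          simp only [Matrix.mul_assoc]
      _ = _ := by rw [hL.orthonormal, Matrix.mul_one]
  have hLU : L * U' = U' * Matrix.diagonal l' - F * U' := by
    rw [hF, Matrix.sub_mul, hWU]; abel
  have h1 : U' * Matrix.diagonal l' = U * (Uᵀ * U' * Matrix.diagonal l' - Uᵀ * F * U') + F * U' := by
    have h2 : U * (Uᵀ * U' * Matrix.diagonal l' - Uᵀ * F * U') = L * U' := by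
      calc _ = U * Uᵀ * (U' * Matrix.diagonal l' - F * U') := by
            simp only [Matrix.mul_sub, Matrix.mul_assoc]
        _ = _ := by rw [← hLU, ← Matrix.mul_assoc, hLL]
    rw [h2, hLU]; abel
  have hdd := diagonal_mul_diagonal_inv hpos
  have h2 : U' = U * (Uᵀ * U' - Uᵀ * F * U' * D) + F * U' * D := by
    calc U' = U' * Matrix.diagonal l' * D := by rw [Matrix.mul_assoc, hdd, Matrix.mul_one]
      _ = _ := by
        rw [h1, Matrix.add_mul, Matrix.mul_assoc U, Matrix.sub_mul,
          Matrix.mul_assoc (Uᵀ * U'), hdd, Matrix.mul_one]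
  have hDn : ‖D‖ ≤ c⁻¹ := opNorm_diagonal_inv_le hc hl'
  have hU := opNorm_le_one_of_orthonormal hL.orthonormal
  have hUt : ‖Uᵀ‖ ≤ 1 := by rwa [opNorm_transpose]
  have hU' := opNorm_le_one_of_orthonormal hL'.orthonormal
  have h3 : ‖Uᵀ * U' - Uᵀ * F * U' * D‖ ≤ 1 * 1 + 1 * f * 1 * c⁻¹ :=
    (norm_sub_le _ _).trans (add_le_add (opNorm_mul_le_of_le hUt hU')
      (opNorm_mul_le_of_le (opNorm_mul_le_of_le (opNorm_mul_le_of_le hUt hf) hU') hDn))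
  have h4 : euclNorm (U' i) ≤ u * (1 * 1 + 1 * f * 1 * c⁻¹) + q * c⁻¹ := by
    conv_lhs => rw [h2]
    exact (euclNorm_add_le _ _).trans (add_le_add (euclNorm_row_mul_le_of_le hu h3)
      (euclNorm_row_mul_le_of_le hq hDn))
  calc _ ≤ _ := h4
    _ = _ := by ring

lemma points_mul_diagonal_inv {U : Matrix (Fin n) (Fin r) ℝ} {l : Fin r → ℝ}
    (hl : ∀ j, 0 < l j) : points U l * Matrix.diagonal (fun j => (l j)⁻¹)
      = U * Matrix.diagonal fun j => (Real.sqrt (l j))⁻¹ := by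
  rw [points, Matrix.mul_assoc, Matrix.diagonal_mul_diagonal]
  congr 2; ext j
  have h1 := Real.mul_self_sqrt (hl j).le
  have h2 := (Real.sqrt_pos.2 (hl j)).ne'
  have h3 := (hl j).ne'
  field_simp
  nlinarith

/-- Row control comes from `Δ Λ' = F X' - X (R Δᵀ X')`: the second term is a row of `X` times a
matrix already bounded in spectral norm. -/
lemma euclNorm_row_points_sub_le {W L L' : Matrix (Fin n) (Fin n) ℝ}
    {U U' : Matrix (Fin n) (Fin r) ℝ} {l l' : Fin r → ℝ} (hL : IsEigDecomp L U l)
    (hl : ∀ j, 0 ≤ l j) (hL' : IsEigDecomp L' U' l') (htop : IsTopPSD r W L')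
    {R : Matrix (Fin r) (Fin r) ℝ} (hR : R ∈ Matrix.orthogonalGroup (Fin r) ℝ) {s x q δ : ℝ}
    (hs : 0 < s) (hl' : ∀ j, s ^ 2 ≤ l' j)
    (hδ : ‖points U' l' - points U l * R‖ ≤ δ) {i : Fin n}
    (hx : euclNorm (points U l i) ≤ x) (hq : euclNorm (((W - L) * U') i) ≤ q) :
    euclNorm ((points U' l' - points U l * R) i) ≤ (x * δ + q) / s := by
  have hpos : ∀ j, 0 < l' j := fun j => (pow_pos hs 2).trans_le (hl' j)
  set X := points U l with hX
  set X' := points U' l' with hX'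
  set Δ := X' - X * R with hΔ
  set F := W - L with hF
  set D := Matrix.diagonal fun j => (l' j)⁻¹ with hD
  set E := Matrix.diagonal fun j => (Real.sqrt (l' j))⁻¹ with hE
  have hRt := orthogonal_transpose_mul hR
  have hRR : R * Rᵀ = 1 := mul_eq_one_comm.1 hRt
  have hXX : X * Xᵀ = L := points_mul_transpose hL hl
  have hX'X' : X'ᵀ * X' = Matrix.diagonal l' := transpose_mul_points hL' fun j => (hpos j).le
  have hWX : W * X' = X' * Matrix.diagonal l' := by
    rw [hX', points, ← Matrix.mul_assoc, mul_eigenvectors htop hL' hpos, Matrix.mul_assoc,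
      Matrix.mul_assoc, Matrix.diagonal_mul_diagonal, Matrix.diagonal_mul_diagonal]
    simp only [mul_comm]
  have hdd := diagonal_mul_diagonal_inv hpos
  have h1 : Δ * Matrix.diagonal l' = F * X' - X * (R * Δᵀ * X') := by
    have h2 : R * Δᵀ * X' = R * Matrix.diagonal l' - Xᵀ * X' := by
      rw [hΔ, Matrix.transpose_sub, Matrix.transpose_mul, Matrix.mul_sub, Matrix.sub_mul,
        Matrix.mul_assoc, hX'X', ← Matrix.mul_assoc R, hRR, Matrix.one_mul]
    rw [h2, hΔ, hF, Matrix.sub_mul, Matrix.sub_mul, Matrix.mul_sub, hWX, ← Matrix.mul_assoc X Xᵀ,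
      hXX, Matrix.mul_assoc]
    abel
  have h2 : Δ = F * U' * E - X * (R * Δᵀ * (U' * E)) := by
    -- `X' Λ'⁻¹ = U' Λ'^{-1/2}`, so the bound loses one factor `s`, not two.
    have hXD : X' * D = U' * E := points_mul_diagonal_inv hpos
    calc Δ = Δ * Matrix.diagonal l' * D := by rw [Matrix.mul_assoc, hdd, Matrix.mul_one]
      _ = _ := by
        rw [h1, Matrix.sub_mul, Matrix.mul_assoc, Matrix.mul_assoc, Matrix.mul_assoc, hXD,
          Matrix.mul_assoc F]
  have hEn : ‖E‖ ≤ s⁻¹ := opNorm_diagonal_inv_le hs fun j =>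
    Real.le_sqrt_of_sq_le (hl' j)
  have hRn := opNorm_le_one_of_orthonormal hRt
  have hU' := opNorm_le_one_of_orthonormal hL'.orthonormal
  have hΔt : ‖Δᵀ‖ ≤ δ := by rwa [opNorm_transpose]
  have h3 := opNorm_mul_le_of_le (opNorm_mul_le_of_le hRn hΔt) (opNorm_mul_le_of_le hU' hEn)
  have h4 : euclNorm (Δ i) ≤ q * s⁻¹ + x * (1 * δ * (1 * s⁻¹)) := by
    conv_lhs => rw [h2]
    exact (euclNorm_sub_le _ _).trans (add_le_add (euclNorm_row_mul_le_of_le hq hEn)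
      (euclNorm_row_mul_le_of_le hx h3))
  calc _ ≤ _ := h4
    _ = _ := by ring

lemma opNorm_points_sub_le {L L' : Matrix (Fin n) (Fin n) ℝ}
    {U U' : Matrix (Fin n) (Fin r) ℝ} {l l' : Fin r → ℝ} (hL : IsEigDecomp L U l)
    (hL' : IsEigDecomp L' U' l') {c c' s g : ℝ} (hc : 0 ≤ c) (hc' : 0 ≤ c')
    (hl : ∀ j, c ≤ l j) (hl' : ∀ j, c' ≤ l' j) (hs : 0 < s) (hsc : s ^ 2 ≤ c + c')
    (hg : ‖L' - L‖ ≤ g) {Y Z : Matrix (Fin r) (Fin r) ℝ} {σ : Fin r → ℝ}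
    (hsvd : IsSVD ((points U l)ᵀ * points U' l') Y σ Z) :
    ‖points U' l' - points U l * (Y * Zᵀ)‖ ≤ 2 * g / s := by
  have hl0 : ∀ j, 0 ≤ l j := fun j => hc.trans (hl j)
  have hl0' : ∀ j, 0 ≤ l' j := fun j => hc'.trans (hl' j)
  set X := points U l with hX
  set X' := points U' l' with hX'
  set R := Y * Zᵀ with hR
  have hRt : Rᵀ * R = 1 := orthogonal_transpose_mul hsvd.rotation_mem
  have hRR : R * Rᵀ = 1 := mul_eq_one_comm.1 hRt
  have hYY := orthogonal_transpose_mul hsvd.left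
  have hXX : X * Xᵀ = L := points_mul_transpose hL hl0
  have hXX' : X' * X'ᵀ = L' := points_mul_transpose hL' hl0'
  have hXtX : Xᵀ * X = Matrix.diagonal l := transpose_mul_points hL hl0
  have hX'X' : X'ᵀ * X' = Matrix.diagonal l' := transpose_mul_points hL' hl0'
  -- The polar rotation `R = Y Zᵀ` is exactly what makes this product symmetric positive
  -- semidefinite.
  have hP : (X * R)ᵀ * X' = Z * Matrix.diagonal σ * Zᵀ := by
    rw [Matrix.transpose_mul, Matrix.mul_assoc, hsvd.eq, hR, Matrix.transpose_mul,
      Matrix.transpose_transpose]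
    calc Z * Yᵀ * (Y * Matrix.diagonal σ * Zᵀ) = Z * (Yᵀ * Y) * Matrix.diagonal σ * Zᵀ := by
          simp only [Matrix.mul_assoc]
      _ = _ := by rw [hYY, Matrix.mul_one]
  refine opNorm_sub_le_of_procrustes ?_ ?_ hs ?_ ?_
  · rw [hP, Matrix.transpose_mul, Matrix.transpose_mul, Matrix.transpose_transpose,
      Matrix.diagonal_transpose, Matrix.mul_assoc]
  · intro v
    rw [hP, dotProduct_eigDecomp_mulVec]
    exact Finset.sum_nonneg fun j _ => mul_nonneg (hsvd.nonneg j) (sq_nonneg _)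
  · rw [hXX', Matrix.transpose_mul, Matrix.mul_assoc, ← Matrix.mul_assoc R, hRR, Matrix.one_mul,
      hXX]
    exact hg
  · intro v
    have hdiag : ∀ (d : Fin r → ℝ) (b : ℝ) (w : Fin r → ℝ), (∀ j, b ≤ d j) →
        b * (w ⬝ᵥ w) ≤ w ⬝ᵥ Matrix.diagonal d *ᵥ w := fun d b w h => by
      simp only [dotProduct, Matrix.mulVec_diagonal, Finset.mul_sum]
      refine Finset.sum_le_sum fun j _ => ?_
      have := mul_le_mul_of_nonneg_right (h j) (mul_self_nonneg (w j))
      linarith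
    have h1 := hdiag l' c' v hl'
    have h2 := hdiag l c (R *ᵥ v) hl
    have h3 : (R *ᵥ v) ⬝ᵥ (R *ᵥ v) = v ⬝ᵥ v := by
      rw [← euclNorm_sq, euclNorm_mulVec_of_orthonormal hRt, euclNorm_sq]
    have h4 : v ⬝ᵥ ((X * R)ᵀ * (X * R)) *ᵥ v = (R *ᵥ v) ⬝ᵥ Matrix.diagonal l *ᵥ (R *ᵥ v) := by
      rw [Matrix.transpose_mul, Matrix.mul_assoc, ← Matrix.mul_assoc Xᵀ, hXtX,
        ← Matrix.mulVec_mulVec, ← Matrix.mulVec_mulVec, Matrix.dotProduct_mulVec,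
        ← Matrix.mulVec_transpose, Matrix.transpose_transpose]
    rw [Matrix.add_mulVec, dotProduct_add, hX'X', h4]
    have h5 := mul_le_mul_of_nonneg_right hsc (by rw [← euclNorm_sq]; positivity : 0 ≤ v ⬝ᵥ v)
    rw [h3] at h2
    linarith

/-- If `Xᵀ X' y = 0`, then `z = X' y` lies in the kernel of `L`, whereas the form of `L'` at `z` is
at least `c ‖z‖²`. This contradicts `‖L' - L‖ < c` unless `y = 0`. -/
lemma exists_isSVD_points {L L' : Matrix (Fin n) (Fin n) ℝ}
    {U U' : Matrix (Fin n) (Fin r) ℝ} {l l' : Fin r → ℝ} (hL : IsEigDecomp L U l)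
    (hl : ∀ j, 0 < l j) (hL' : IsEigDecomp L' U' l') {c : ℝ}
    (hlt : ‖L' - L‖ < c) (hl' : ∀ j, c ≤ l' j) :
    ∃ (Y : Matrix (Fin r) (Fin r) ℝ) (σ : Fin r → ℝ) (Z : Matrix (Fin r) (Fin r) ℝ),
      IsSVD ((points U l)ᵀ * points U' l') Y σ Z := by
  have hc : 0 < c := (norm_nonneg _).trans_lt hlt
  have hpos : ∀ j, 0 < l' j := fun j => hc.trans_le (hl' j)
  refine exists_isSVD fun y hy => ?_
  by_contra hy0
  set z := points U' l' *ᵥ y with hz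
  have hz2 : euclNorm z ^ 2 = ∑ j, l' j * y j ^ 2 := by
    rw [euclNorm_sq, hz, Matrix.dotProduct_mulVec, ← Matrix.mulVec_transpose,
      Matrix.mulVec_mulVec, transpose_mul_points hL' fun j => (hpos j).le]
    simp only [dotProduct, Matrix.mulVec_diagonal]
    exact Finset.sum_congr rfl fun j _ => by ring
  have hz0 : 0 < euclNorm z := by
    have h1 : 0 < euclNorm z ^ 2 := by
      rw [hz2]
      have h2 := euclNorm_pos hy0
      have h3 : c * euclNorm y ^ 2 ≤ ∑ j, l' j * y j ^ 2 := by
        rw [euclNorm_sq_eq_sum, Finset.mul_sum]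
        exact Finset.sum_le_sum fun i _ => mul_le_mul_of_nonneg_right (hl' i) (sq_nonneg _)
      exact (by positivity : 0 < c * euclNorm y ^ 2).trans_le h3
    exact (euclNorm_nonneg z).lt_of_ne fun h => by rw [← h] at h1; simp at h1
  have hLz : L *ᵥ z = 0 := by
    rw [← points_mul_transpose hL fun j => (hl j).le, hz, ← Matrix.mulVec_mulVec,
      Matrix.mulVec_mulVec y, hy, Matrix.mulVec_zero]
  have hq : z ⬝ᵥ L' *ᵥ z = ∑ j, l' j * (l' j * y j ^ 2) := by
    rw [← points_mul_transpose hL' fun j => (hpos j).le, ← Matrix.mulVec_mulVec,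
      Matrix.dotProduct_mulVec, ← Matrix.mulVec_transpose, hz, Matrix.mulVec_mulVec,
      transpose_mul_points hL' fun j => (hpos j).le]
    simp only [dotProduct, Matrix.mulVec_diagonal]
    exact Finset.sum_congr rfl fun j _ => by ring
  have h1 : c * euclNorm z ^ 2 ≤ z ⬝ᵥ L' *ᵥ z := by
    rw [hq, hz2, Finset.mul_sum]
    exact Finset.sum_le_sum fun j _ => mul_le_mul_of_nonneg_right (hl' j)
      (mul_nonneg (hpos j).le (sq_nonneg _))
  have h2 := (abs_le.1 (dotProduct_mulVec_le (L' - L) z z)).2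
  rw [Matrix.sub_mulVec, hLz, sub_zero] at h2
  nlinarith [pow_pos hz0 2]

end Perturbation

/-! ### One step of the iteration: closeness in, closeness out -/

section Iterates

open scoped Matrix.Norms.L2Operator

variable {n r : ℕ}

/-- `L = U diag(l) Uᵀ` has rank `r`, its nonzero eigenvalues lie in `[sr², s1²]`, and the rows of
`U` have norm at most `u`. -/
structure IsReference (L : Matrix (Fin n) (Fin n) ℝ) (U : Matrix (Fin n) (Fin r) ℝ)
    (l : Fin r → ℝ) (sr s1 u : ℝ) : Prop where
  eig : IsEigDecomp L U l
  sr_pos : 0 < sr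
  sr_le : sr ≤ s1
  lower : ∀ j, sr ^ 2 ≤ l j
  upper : ∀ j, l j ≤ s1 ^ 2
  u_nonneg : 0 ≤ u
  rows : ∀ i, euclNorm (U i) ≤ u

/-- `L' = U' diag(l') U'ᵀ` approximates `L = U diag(l) Uᵀ` with relative accuracy `ρ`: in the
spectral norm, and row by row after an optimal rotation of the factors. -/
structure IsClose (U : Matrix (Fin n) (Fin r) ℝ) (l : Fin r → ℝ) (sr s1 u : ℝ)
    (L' : Matrix (Fin n) (Fin n) ℝ) (U' : Matrix (Fin n) (Fin r) ℝ) (l' : Fin r → ℝ) (ρ : ℝ) :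
    Prop where
  eig : IsEigDecomp L' U' l'
  nonneg : ∀ j, 0 ≤ l' j
  rows : ∀ i, euclNorm (U' i) ≤ 11 / 10 * u
  exists_svd : ∃ (Y : Matrix (Fin r) (Fin r) ℝ) (σ : Fin r → ℝ) (Z : Matrix (Fin r) (Fin r) ℝ),
      IsSVD ((points U l)ᵀ * points U' l') Y σ Z
  opNorm_sub : ∀ (Y : Matrix (Fin r) (Fin r) ℝ) (σ : Fin r → ℝ) (Z : Matrix (Fin r) (Fin r) ℝ),
      IsSVD ((points U l)ᵀ * points U' l') Y σ Z →
      ‖points U' l' - points U l * (Y * Zᵀ)‖ ≤ 7 / 2 * ρ * sr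
  rows_sub : ∀ (Y : Matrix (Fin r) (Fin r) ℝ) (σ : Fin r → ℝ) (Z : Matrix (Fin r) (Fin r) ℝ),
      IsSVD ((points U l)ᵀ * points U' l') Y σ Z →
      ∀ i, euclNorm ((points U' l' - points U l * (Y * Zᵀ)) i) ≤ 8 * u * s1 * ρ

variable {L L' W : Matrix (Fin n) (Fin n) ℝ} {U U' : Matrix (Fin n) (Fin r) ℝ}
  {l l' : Fin r → ℝ} {sr s1 u ρ : ℝ}

lemma IsReference.pos (h : IsReference L U l sr s1 u) (j : Fin r) : 0 < l j :=
  (pow_pos h.sr_pos 2).trans_le (h.lower j)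

lemma IsReference.s1_pos (h : IsReference L U l sr s1 u) : 0 < s1 := h.sr_pos.trans_le h.sr_le

lemma IsReference.rows_points (h : IsReference L U l sr s1 u) (i : Fin n) :
    euclNorm (points U l i) ≤ u * s1 :=
  euclNorm_row_mul_le_of_le (h.rows i) (opNorm_diagonal_le h.s1_pos.le fun j => by
    rw [abs_of_nonneg (Real.sqrt_nonneg _)]
    exact Real.sqrt_le_iff.2 ⟨h.s1_pos.le, h.upper j⟩)

lemma IsReference.eigenvalue_ge (h : IsReference L U l sr s1 u) (hL' : IsEigDecomp L' U' l')
    (htop : IsTopPSD r W L') (hρ : ρ ≤ 3 / 203) (hF : ‖W - L‖ ≤ 6 / 5 * ρ * sr ^ 2)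
    (j : Fin r) : 24 / 25 * sr ^ 2 ≤ l' j := by
  have h1 := opNorm_topPSD_sub_le_two_mul h.eig (fun j => (h.pos j).le) htop
  have h2 := pow_pos h.sr_pos 2
  have h3 := sub_opNorm_le_eigenvalue h.eig hL' h.lower (by nlinarith) j
  nlinarith

/-- One truncation step: a small perturbation of `L` that is also small row by row keeps the
iterate close to `L`. -/
lemma IsReference.isClose (h : IsReference L U l sr s1 u) (hL' : IsEigDecomp L' U' l')
    (htop : IsTopPSD r W L') (hρ0 : 0 ≤ ρ) (hρ : ρ ≤ 3 / 203)
    (hF : ‖W - L‖ ≤ 6 / 5 * ρ * sr ^ 2)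
    (hrow : ∀ i, euclNorm (((W - L) * U') i) ≤ 4 * u * ρ * sr ^ 2) :
    IsClose U l sr s1 u L' U' l' ρ := by
  have hsr := h.sr_pos
  have hs2 := pow_pos hsr 2
  have hu := h.u_nonneg
  have hl0 : ∀ j, 0 ≤ l j := fun j => (h.pos j).le
  have hl' := h.eigenvalue_ge hL' htop hρ hF
  have hc : 0 < 24 / 25 * sr ^ 2 := by positivity
  have hsub : ‖L' - L‖ ≤ 12 / 5 * ρ * sr ^ 2 := by
    have := opNorm_topPSD_sub_le_two_mul h.eig hl0 htop
    linarith
  have hop : ∀ (Y : Matrix (Fin r) (Fin r) ℝ) (σ : Fin r → ℝ) (Z : Matrix (Fin r) (Fin r) ℝ),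
      IsSVD ((points U l)ᵀ * points U' l') Y σ Z →
      ‖points U' l' - points U l * (Y * Zᵀ)‖ ≤ 7 / 2 * ρ * sr := fun Y σ Z hsvd => by
    -- `(7/5)² = 1 + 24/25`, and `2 · (12/5) / (7/5) = 24/7 ≤ 7/2`.
    refine (opNorm_points_sub_le (s := 7 / 5 * sr) h.eig hL' hs2.le hc.le h.lower hl'
      (by positivity) (by nlinarith) hsub hsvd).trans ?_
    rw [div_le_iff₀ (by positivity)]
    nlinarith [mul_nonneg hρ0 hs2.le]
  refine ⟨hL', fun j => hc.le.trans (hl' j), fun i => ?_, ?_, hop, fun Y σ Z hsvd i => ?_⟩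
  · refine (euclNorm_row_eigenvectors_le h.eig hL' htop hc hl' hF (h.rows i) (hrow i)).trans ?_
    have e1 : 6 / 5 * ρ * sr ^ 2 / (24 / 25 * sr ^ 2) = 5 / 4 * ρ := by
      field_simp; ring
    have e2 : 4 * u * ρ * sr ^ 2 / (24 / 25 * sr ^ 2) = 25 / 6 * (u * ρ) := by
      field_simp; ring
    rw [e1, e2]
    nlinarith [mul_le_mul_of_nonneg_left hρ hu]
  · exact exists_isSVD_points h.eig h.pos hL' (hsub.trans_lt (by nlinarith)) hl'
  -- `979/1000` lies just below `√(24/25)`, and `(7/2 + 4) / 0.979 < 8`.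
  · refine (euclNorm_row_points_sub_le (s := 979 / 1000 * sr) h.eig hl0 hL' htop
      hsvd.rotation_mem (by positivity) (fun j => ?_) (hop Y σ Z hsvd) (h.rows_points i)
      (hrow i)).trans ?_
    · refine le_trans ?_ (hl' j); nlinarith
    · rw [div_le_iff₀ (by positivity)]
      have h1 : 0 ≤ u * ρ * sr := by positivity
      have h2 := mul_le_mul_of_nonneg_left h.sr_le h1
      have h3 : 0 ≤ u * ρ * sr * s1 := mul_nonneg h1 h.s1_pos.le
      nlinarith

/-- Telescope `L' - L = Δ X'ᵀ + X R Δᵀ` and apply Cauchy–Schwarz to rows; `17` bounds `16 + 64 ρ`.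
-/
lemma IsClose.abs_sub_le (h : IsReference L U l sr s1 u)
    (hcl : IsClose U l sr s1 u L' U' l' ρ) (hρ0 : 0 ≤ ρ) (hρ : ρ ≤ 3 / 203) (i j : Fin n) :
    |(L' - L) i j| ≤ 17 * u ^ 2 * s1 ^ 2 * ρ := by
  obtain ⟨Y, σ, Z, hsvd⟩ := hcl.exists_svd
  have hrows := hcl.rows_sub Y σ Z hsvd
  have hRt := orthogonal_transpose_mul hsvd.rotation_mem
  set R := Y * Zᵀ with hR
  have hRR : R * Rᵀ = 1 := mul_eq_one_comm.1 hRt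
  have hXX := points_mul_transpose h.eig fun j => (h.pos j).le
  have hXX' := points_mul_transpose hcl.eig hcl.nonneg
  set X := points U l with hX
  set X' := points U' l' with hX'
  have hXR : ∀ i, euclNorm ((X * R) i) ≤ u * s1 := fun i => by
    simpa using euclNorm_row_mul_le_of_le (h.rows_points i) (opNorm_le_one_of_orthonormal hRt)
  set Δ := X' - X * R with hΔ
  have hX'r : ∀ i, euclNorm (X' i) ≤ 8 * u * s1 * ρ + u * s1 := fun i => by
    have h1 := euclNorm_add_le (Δ i) ((X * R) i)
    have h2 : Δ i + (X * R) i = X' i := by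
      ext k; simp [hΔ]
    rw [h2] at h1
    exact h1.trans (add_le_add (hrows i) (hXR i))
  have hdec : L' - L = Δ * X'ᵀ + X * R * Δᵀ := by
    have h1 : X * R * (X * R)ᵀ = L := by
      rw [Matrix.transpose_mul, Matrix.mul_assoc, ← Matrix.mul_assoc R, hRR, Matrix.one_mul, hXX]
    rw [hΔ, Matrix.sub_mul, Matrix.transpose_sub, Matrix.mul_sub, h1, hXX']
    abel
  have hu := h.u_nonneg
  have hs1 := h.s1_pos.le
  rw [hdec, Matrix.add_apply]
  calc _ ≤ |(Δ * X'ᵀ) i j| + |(X * R * Δᵀ) i j| := abs_add_le _ _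
    _ ≤ 8 * u * s1 * ρ * (8 * u * s1 * ρ + u * s1) + u * s1 * (8 * u * s1 * ρ) := by
        refine add_le_add ((abs_mul_transpose_le _ _ i j).trans ?_)
          ((abs_mul_transpose_le _ _ i j).trans ?_)
        · exact mul_le_mul (hrows i) (hX'r j) (euclNorm_nonneg _) (by positivity)
        · exact mul_le_mul (hXR i) (hrows j) (euclNorm_nonneg _) (by positivity)
    _ = u ^ 2 * s1 ^ 2 * ρ * (64 * ρ + 16) := by ring
    _ ≤ u ^ 2 * s1 ^ 2 * ρ * 17 := mul_le_mul_of_nonneg_left (by linarith) (by positivity)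
    _ = _ := by ring

lemma tangentProj_eq_sub (U : Matrix (Fin n) (Fin r) ℝ) (Z : Matrix (Fin n) (Fin n) ℝ) :
    tangentProj U Z = Z - (1 - U * Uᵀ) * Z * (1 - U * Uᵀ) := by
  rw [tangentProj]; noncomm_ring

/-- Besides the projected error, only the component of `L` normal to the tangent space remains. -/
lemma tangentProj_add_sub (U : Matrix (Fin n) (Fin r) ℝ) (L G : Matrix (Fin n) (Fin n) ℝ) :
    tangentProj U (L + G) - L = tangentProj U G - (1 - U * Uᵀ) * L * (1 - U * Uᵀ) := by
  rw [tangentProj_eq_sub, tangentProj_eq_sub]; noncomm_ring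

lemma transpose_complement (U : Matrix (Fin n) (Fin r) ℝ) :
    (1 - U * Uᵀ)ᵀ = 1 - U * Uᵀ := by
  simp [Matrix.transpose_mul]

lemma complement_mul_self {U : Matrix (Fin n) (Fin r) ℝ} (h : Uᵀ * U = 1) :
    (1 - U * Uᵀ) * U = 0 := by
  rw [Matrix.sub_mul, Matrix.one_mul, Matrix.mul_assoc, h, Matrix.mul_one, sub_self]

lemma opNorm_complement_le_one {U : Matrix (Fin n) (Fin r) ℝ} (h : Uᵀ * U = 1) :
    ‖1 - U * Uᵀ‖ ≤ 1 := by
  refine opNorm_le_one_of_projection (transpose_complement U) ?_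
  conv_lhs => rw [Matrix.mul_sub, Matrix.mul_one, ← Matrix.mul_assoc, complement_mul_self h]
  simp

/-- The perturbation of `L` seen by the iteration that projects onto the tangent space at a
matrix close to `L`. -/
lemma IsClose.tangentProj_bounds (h : IsReference L U l sr s1 u)
    (hcl : IsClose U l sr s1 u L' U' l' ρ) (hρ0 : 0 ≤ ρ) {γ : ℝ}
    (hρ : ρ * s1 ^ 2 ≤ 3 / 203 * γ * sr ^ 2) {G : Matrix (Fin n) (Fin n) ℝ}
    (hG : ‖G‖ ≤ γ * ρ * sr ^ 2 / 2)
    (hGr : ∀ i, euclNorm ((G * U') i) ≤ 2 * (γ * ρ * sr ^ 2) * (11 / 10 * u)) :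
    ‖tangentProj U' (L + G) - L‖ ≤ 6 / 5 * (γ * ρ) * sr ^ 2 ∧
    ∀ V : Matrix (Fin n) (Fin r) ℝ, ‖V‖ ≤ 1 → ∀ i,
      euclNorm (((tangentProj U' (L + G) - L) * V) i) ≤ 4 * u * (γ * ρ) * sr ^ 2 := by
  obtain ⟨Y, σ, Z, hsvd⟩ := hcl.exists_svd
  have hrows := hcl.rows_sub Y σ Z hsvd
  have hop := hcl.opNorm_sub Y σ Z hsvd
  have hRt := orthogonal_transpose_mul hsvd.rotation_mem
  set R := Y * Zᵀ with hR
  have hRR : R * Rᵀ = 1 := mul_eq_one_comm.1 hRt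
  have hXX := points_mul_transpose h.eig fun j => (h.pos j).le
  set X := points U l with hX
  set Δ := points U' l' - X * R with hΔ
  set P := 1 - U' * U'ᵀ with hP
  have hPt : Pᵀ = P := transpose_complement U'
  have hPn : ‖P‖ ≤ 1 := opNorm_complement_le_one hcl.eig.orthonormal
  have hU' := opNorm_le_one_of_orthonormal hcl.eig.orthonormal
  have hU't : ‖U'ᵀ‖ ≤ 1 := by rwa [opNorm_transpose]
  set N := P * Δ with hN
  have hPX : P * points U' l' = 0 := by
    rw [points, ← Matrix.mul_assoc, complement_mul_self hcl.eig.orthonormal, Matrix.zero_mul]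
  -- `P` annihilates `X'`, hence `P X R = -P Δ`: the normal part of `L` is quadratic in `Δ`.
  have hPL : P * L * P = N * Nᵀ := by
    have h1 : N = -(P * (X * R)) := by rw [hN, hΔ, Matrix.mul_sub, hPX, zero_sub]
    rw [h1, Matrix.transpose_neg, Matrix.neg_mul, Matrix.mul_neg, neg_neg, Matrix.transpose_mul,
      Matrix.transpose_mul, hPt, ← hXX]
    calc P * (X * Xᵀ) * P = P * (X * (R * Rᵀ) * Xᵀ) * P := by rw [hRR, Matrix.mul_one]
      _ = _ := by simp only [Matrix.mul_assoc]
  have hsr := h.sr_pos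
  have hu := h.u_nonneg
  have hs1 := h.s1_pos
  have hs2 := pow_pos hsr 2
  have hss : sr ^ 2 ≤ s1 * sr := by nlinarith [h.sr_le]
  have hss' : s1 * sr ≤ s1 ^ 2 := by nlinarith [h.sr_le]
  have hδ0 : 0 ≤ 7 / 2 * ρ * sr := by positivity
  have hNn : ‖N‖ ≤ 7 / 2 * ρ * sr := by simpa using opNorm_mul_le_of_le hPn hop
  have hNt : ‖Nᵀ‖ ≤ 7 / 2 * ρ * sr := by rwa [opNorm_transpose]
  have hρs : ρ * (s1 * sr) ≤ 3 / 203 * γ * sr ^ 2 :=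
    (mul_le_mul_of_nonneg_left hss' hρ0).trans hρ
  have hρs' : ρ * sr ^ 2 ≤ 3 / 203 * γ * sr ^ 2 :=
    (mul_le_mul_of_nonneg_left hss hρ0).trans hρs
  have hγρ : 0 ≤ γ * ρ * sr ^ 2 := by
    have := norm_nonneg G; linarith
  rw [tangentProj_add_sub, ← hP, hPL]
  constructor
  · have h1 : ‖tangentProj U' G‖ ≤ γ * ρ * sr ^ 2 := by
      rw [tangentProj_eq_sub, ← hP]
      have h2 := opNorm_mul_le_of_le (opNorm_mul_le_of_le hPn hG) hPn
      have := norm_sub_le G (P * G * P)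
      linarith
    have h3 := opNorm_mul_le_of_le hNn hNt
    have h4 := norm_sub_le (tangentProj U' G) (N * Nᵀ)
    have h5 := mul_le_mul_of_nonneg_left hρs' hρ0
    nlinarith
  · intro V hV i
    have hN_row : euclNorm (N i) ≤ 8 * u * s1 * ρ + 11 / 10 * u * (7 / 2 * ρ * sr) := by
      have h1 : N = Δ - U' * (U'ᵀ * Δ) := by
        rw [hN, hP, Matrix.sub_mul, Matrix.one_mul, Matrix.mul_assoc]
      rw [h1]
      refine (euclNorm_sub_le (Δ i) _).trans (add_le_add (hrows i) ?_)
      exact euclNorm_row_mul_le_of_le (hcl.rows i)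
        (by simpa using opNorm_mul_le_of_le hU't hop)
    -- Grouped so that every term starts with `U'`, `G U'` or `N`, whose rows are controlled; `V`
    -- enters only through its norm. The four terms contribute `11/20 + 11/5 + 11/20 + 7/10 = 4`.
    have e1 : (tangentProj U' G - N * Nᵀ) * V
        = U' * (U'ᵀ * G * V) + (G * U') * (U'ᵀ * V) - U' * (U'ᵀ * G * (U' * (U'ᵀ * V)))
          - N * (Nᵀ * V) := by
      rw [tangentProj]
      simp only [Matrix.sub_mul, Matrix.add_mul, Matrix.mul_assoc]
    have hUV := opNorm_mul_le_of_le hU't hV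
    have b1 := euclNorm_row_mul_le_of_le (hcl.rows i)
      (opNorm_mul_le_of_le (opNorm_mul_le_of_le hU't hG) hV)
    have b2 := euclNorm_row_mul_le_of_le (hGr i) hUV
    have b3 := euclNorm_row_mul_le_of_le (hcl.rows i)
      (opNorm_mul_le_of_le (opNorm_mul_le_of_le hU't hG) (opNorm_mul_le_of_le hU' hUV))
    have b4 := euclNorm_row_mul_le_of_le hN_row (opNorm_mul_le_of_le hNt hV)
    have b5 : (8 * u * s1 * ρ + 11 / 10 * u * (7 / 2 * ρ * sr)) * (7 / 2 * ρ * sr * 1)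
        ≤ 7 / 10 * u * (γ * ρ * sr ^ 2) := by
      have c1 := mul_le_mul_of_nonneg_left hρs (mul_nonneg hu hρ0)
      have c2 := mul_le_mul_of_nonneg_left hρs' (mul_nonneg hu hρ0)
      nlinarith [mul_nonneg hu hγρ]
    rw [e1]
    have t1 := euclNorm_sub_le ((U' * (U'ᵀ * G * V) + (G * U') * (U'ᵀ * V)
      - U' * (U'ᵀ * G * (U' * (U'ᵀ * V)))) i) ((N * (Nᵀ * V)) i)
    have t2 := euclNorm_sub_le ((U' * (U'ᵀ * G * V) + (G * U') * (U'ᵀ * V)) i)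
      ((U' * (U'ᵀ * G * (U' * (U'ᵀ * V)))) i)
    have t3 := euclNorm_add_le ((U' * (U'ᵀ * G * V)) i) (((G * U') * (U'ᵀ * V)) i)
    have t4 : euclNorm ((U' * (U'ᵀ * G * V) + (G * U') * (U'ᵀ * V)
          - U' * (U'ᵀ * G * (U' * (U'ᵀ * V))) - N * (Nᵀ * V)) i)
        ≤ euclNorm ((U' * (U'ᵀ * G * V)) i) + euclNorm (((G * U') * (U'ᵀ * V)) i)
          + euclNorm ((U' * (U'ᵀ * G * (U' * (U'ᵀ * V)))) i) + euclNorm ((N * (Nᵀ * V)) i) :=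
      t1.trans (by gcongr; exact t2.trans (by gcongr; exact t3))
    nlinarith [mul_nonneg hu hγρ]

/-- The perturbation of the first step, whose row bound is not explicit in advance: it is
proportional to the rows of the eigenvectors it produces. -/
lemma IsReference.isClose_of_rows (h : IsReference L U l sr s1 u) (hL' : IsEigDecomp L' U' l')
    (htop : IsTopPSD r W L') (hρ0 : 0 ≤ ρ) (hρ : ρ ≤ 3 / 203)
    (hF : ‖W - L‖ ≤ ρ * sr ^ 2 / 2)
    (hrow : ∀ m : ℝ, 0 ≤ m → (∀ i, euclNorm (U' i) ≤ m) →
      ∀ i, euclNorm (((W - L) * U') i) ≤ 2 * (ρ * sr ^ 2) * m) :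
    IsClose U l sr s1 u L' U' l' ρ := by
  have hsr := h.sr_pos
  have hs2 := pow_pos hsr 2
  have hu := h.u_nonneg
  have hF' : ‖W - L‖ ≤ 6 / 5 * ρ * sr ^ 2 := hF.trans (by nlinarith [mul_nonneg hρ0 hs2.le])
  have hl' := h.eigenvalue_ge hL' htop hρ hF'
  have hc : 0 < 24 / 25 * sr ^ 2 := by positivity
  have hm : ∀ i, euclNorm (U' i) ≤ 11 / 10 * u := by
    intro i
    have : Nonempty (Fin n) := ⟨i⟩
    -- At the largest row norm `m` the estimate reads `m ≤ u (1 + 25ρ/48) + 25ρm/12`; the last term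
    -- is absorbed because `ρ ≤ 3/203`.
    obtain ⟨i0, hi0⟩ := Finite.exists_max fun i => euclNorm (U' i)
    refine (hi0 i).trans ?_
    set m := euclNorm (U' i0) with hmdef
    have hm0 : 0 ≤ m := euclNorm_nonneg _
    have h1 := euclNorm_row_eigenvectors_le h.eig hL' htop hc hl' hF (h.rows i0)
      (hrow m hm0 hi0 i0)
    have e1 : ρ * sr ^ 2 / 2 / (24 / 25 * sr ^ 2) = 25 / 48 * ρ := by
      field_simp; ring
    have e2 : 2 * (ρ * sr ^ 2) * m / (24 / 25 * sr ^ 2) = 25 / 12 * (ρ * m) := by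
      field_simp; ring
    rw [e1, e2, ← hmdef] at h1
    nlinarith [mul_le_mul_of_nonneg_left hρ hu, mul_le_mul_of_nonneg_right hρ hm0]
  refine h.isClose hL' htop hρ0 hρ hF' fun i => ?_
  refine (hrow _ (by positivity) hm i).trans ?_
  nlinarith [mul_nonneg hu (mul_nonneg hρ0 hs2.le)]

end Iterates

/-! ### Centering, sparse thresholding errors, and the induction -/

section SparsePart

open scoped Matrix.Norms.L2Operator

variable {n r : ℕ}

lemma centering_apply (i j : Fin n) :
    centering n i j = (if i = j then 1 else 0) - (n : ℝ)⁻¹ := by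
  simp [centering, Matrix.one_apply]

lemma centering_transpose : (centering n)ᵀ = centering n := by
  ext i j
  simp [centering_apply, eq_comm]

lemma sum_centering (hn : 0 < n) (j : Fin n) : ∑ i, centering n i j = 0 := by
  have : (n : ℝ) ≠ 0 := by positivity
  simp [centering_apply, Finset.sum_sub_distrib, this]

lemma centering_mul_of_sum_eq_zero {m : ℕ} {Z : Matrix (Fin n) (Fin m) ℝ}
    (h : ∀ j, ∑ i, Z i j = 0) : centering n * Z = Z := by
  ext i j
  simp only [Matrix.mul_apply, centering_apply, sub_mul, Finset.sum_sub_distrib,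
    ← Finset.mul_sum, h j]
  simp

lemma centering_mul_self (hn : 0 < n) : centering n * centering n = centering n :=
  centering_mul_of_sum_eq_zero (sum_centering hn)

lemma opNorm_centering_le_one (hn : 0 < n) : ‖centering n‖ ≤ 1 :=
  opNorm_le_one_of_projection centering_transpose (centering_mul_self hn)

lemma sum_abs_centering_le (hn : 0 < n) (i : Fin n) : ∑ j, |centering n i j| ≤ 2 := by
  have hn' : (n : ℝ) ≠ 0 := by positivity
  calc ∑ j, |centering n i j| ≤ ∑ j : Fin n, ((if i = j then 1 else 0) + (n : ℝ)⁻¹) := by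
        refine Finset.sum_le_sum fun j _ => ?_
        rw [centering_apply]
        refine (abs_sub _ _).trans (le_of_eq ?_)
        rw [abs_of_nonneg (inv_nonneg.2 (Nat.cast_nonneg n : (0 : ℝ) ≤ n))]
        split_ifs <;> simp
    _ = 2 := by simp [Finset.sum_add_distrib, hn']; norm_num

lemma opB_add (Z Z' : Matrix (Fin n) (Fin n) ℝ) : opB (Z + Z') = opB Z + opB Z' := by
  rw [opB, opB, opB, Matrix.mul_add, Matrix.add_mul, smul_add]

lemma opNorm_opB_le (hn : 0 < n) {E : Matrix (Fin n) (Fin n) ℝ} {a : ℝ} (hE : ‖E‖ ≤ a) :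
    ‖opB E‖ ≤ a / 2 := by
  have hJ := opNorm_centering_le_one hn
  have h := opNorm_mul_le_of_le (opNorm_mul_le_of_le hJ hE) hJ
  rw [opB, norm_smul]
  norm_num
  linarith

/-- Each factor `J` has absolute row sums at most `2`, so the constant is `2 · 2 / 2`. -/
lemma euclNorm_row_opB_mul_le (hn : 0 < n) {E : Matrix (Fin n) (Fin n) ℝ} {a : ℝ}
    (hE : ∀ i, ∑ j, |E i j| ≤ a) {V : Matrix (Fin n) (Fin r) ℝ} {m : ℝ} (hm : 0 ≤ m)
    (hV : ∀ i, euclNorm (V i) ≤ m) (i : Fin n) : euclNorm ((opB E * V) i) ≤ 2 * a * m := by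
  have ha : 0 ≤ a := (Finset.sum_nonneg fun j _ => abs_nonneg _).trans (hE i)
  have h1 : ∀ i, euclNorm ((centering n * V) i) ≤ 2 * m := fun i =>
    euclNorm_row_mul_le_of_sum hm (sum_abs_centering_le hn i) hV
  have h2 : ∀ i, euclNorm ((E * (centering n * V)) i) ≤ a * (2 * m) := fun i =>
    euclNorm_row_mul_le_of_sum (by positivity) (hE i) h1
  have h3 := euclNorm_row_mul_le_of_sum (by positivity) (sum_abs_centering_le hn i) h2
  have h4 : (opB E * V) i = (-(1 / 2 : ℝ)) • (centering n * (E * (centering n * V))) i := by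
    rw [opB, Matrix.smul_mul, Matrix.mul_assoc, Matrix.mul_assoc]
    rfl
  rw [h4, euclNorm_smul]
  norm_num
  linarith

lemma sum_centered (hn : 0 < n) (X : Matrix (Fin n) (Fin r) ℝ) (j : Fin r) :
    ∑ i, centered X i j = 0 := by
  have hn' : (n : ℝ) ≠ 0 := by positivity
  simp [centered, Finset.sum_sub_distrib]
  field_simp
  simp

lemma edm_eq_opA_gram (X : Matrix (Fin n) (Fin r) ℝ) : edm X = opA (gram X) := by
  ext i j
  simp only [edm, opA, gram, Matrix.of_apply, Matrix.mul_apply, Matrix.transpose_apply,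
    Finset.mul_sum, ← Finset.sum_add_distrib, ← Finset.sum_sub_distrib]
  refine Finset.sum_congr rfl fun l _ => ?_
  simp only [centered, Matrix.of_apply]
  ring

lemma opB_edm (hn : 0 < n) (X : Matrix (Fin n) (Fin r) ℝ) : opB (edm X) = gram X := by
  set d : Matrix (Fin n) (Fin n) ℝ := Matrix.of fun i _ => gram X i i with hd
  have hA : edm X = d + dᵀ - (2 : ℝ) • gram X := by
    rw [edm_eq_opA_gram]; ext i j; simp [opA, hd]
  have h1 : d * centering n = 0 := by
    ext i j
    simp [Matrix.mul_apply, hd, ← Finset.mul_sum, sum_centering hn]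
  have h2 : centering n * dᵀ = 0 := by
    rw [← centering_transpose, ← Matrix.transpose_mul, h1, Matrix.transpose_zero]
  have h3 : centering n * centered X = centered X := centering_mul_of_sum_eq_zero (sum_centered hn X)
  have h4 : centering n * gram X * centering n = gram X := by
    rw [gram, ← Matrix.mul_assoc, h3, Matrix.mul_assoc]
    conv_lhs => rw [← centering_transpose, ← Matrix.transpose_mul, h3]
  rw [opB, hA, Matrix.mul_sub, Matrix.mul_add, h2, add_zero, Matrix.sub_mul, Matrix.mul_assoc, h1,
    Matrix.mul_zero, Matrix.mul_smul, Matrix.smul_mul, h4, zero_sub, smul_neg, smul_smul]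
  norm_num

lemma abs_opA_le {Z : Matrix (Fin n) (Fin n) ℝ} {c : ℝ} (h : ∀ i j, |Z i j| ≤ c) (i j : Fin n) :
    |opA Z i j| ≤ 4 * c := by
  have h1 := abs_le.1 (h i i)
  have h2 := abs_le.1 (h j j)
  have h3 := abs_le.1 (h i j)
  simp only [opA, Matrix.of_apply]
  rw [abs_le]; constructor <;> linarith

lemma opA_sub (Z Z' : Matrix (Fin n) (Fin n) ℝ) : opA (Z - Z') = opA Z - opA Z' := by
  ext i j
  simp [opA]
  ring

lemma sub_hardThreshold_eq_zero {D S M : Matrix (Fin n) (Fin n) ℝ} {ξ : ℝ}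
    {i j : Fin n} (h : |(D - M) i j| ≤ ξ) (hS : S i j = 0) :
    (S - hardThreshold ξ (D + S - M)) i j = 0 := by
  simp only [Matrix.sub_apply] at h
  simp [hardThreshold, hS, not_lt.2 h]

/-- A kept entry leaves the error `M - D`, at most `ξ`; a discarded one satisfies `|D + S - M| ≤ ξ`,
hence `|S| ≤ 2 ξ`. -/
lemma abs_sub_hardThreshold_le {D S M : Matrix (Fin n) (Fin n) ℝ} {ξ : ℝ}
    {i j : Fin n} (h : |(D - M) i j| ≤ ξ) :
    |(S - hardThreshold ξ (D + S - M)) i j| ≤ 2 * ξ := by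
  simp only [Matrix.sub_apply] at h
  have h0 := abs_nonneg (D i j - M i j)
  change |S i j - (if ξ < |D i j + S i j - M i j| then D i j + S i j - M i j else 0)| ≤ 2 * ξ
  have h1 := abs_le.1 h
  by_cases hlt : ξ < |D i j + S i j - M i j|
  · rw [if_pos hlt, abs_le]; constructor <;> linarith
  · rw [if_neg hlt]
    have h2 := abs_le.1 (not_lt.1 hlt)
    rw [abs_le]; constructor <;> linarith

lemma sum_abs_le_of_card {ι : Type*} [Fintype ι] {s : ι → ℝ} [DecidablePred fun j => s j ≠ 0]
    {e : ι → ℝ} {b c : ℝ} (hc : 0 ≤ c)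
    (hs : ((Finset.univ.filter fun j => s j ≠ 0).card : ℝ) ≤ b) (h0 : ∀ j, s j = 0 → e j = 0)
    (he : ∀ j, |e j| ≤ c) : ∑ j, |e j| ≤ b * c := by
  calc ∑ j, |e j| = ∑ j ∈ Finset.univ.filter fun j => s j ≠ 0, |e j| := by
        refine (Finset.sum_filter_of_ne (p := fun j => s j ≠ 0) fun j _ hj hsj => hj ?_).symm
        rw [h0 j hsj, abs_zero]
    _ ≤ (Finset.univ.filter fun j => s j ≠ 0).card • c :=
        Finset.sum_le_card_nsmul _ _ _ fun j _ => he j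
    _ ≤ b * c := by rw [nsmul_eq_mul]; exact mul_le_mul_of_nonneg_right hs hc

/-- The error of the thresholded outlier estimate, after applying `ℬ`. -/
lemma opB_error_bounds (hn : 0 < n) {α ξ : ℝ} {D S M : Matrix (Fin n) (Fin n) ℝ}
    (hS : IsSparse α S) (hξ : 0 ≤ ξ) (h : ∀ i j, |(D - M) i j| ≤ ξ) :
    ‖opB (S - hardThreshold ξ (D + S - M))‖ ≤ α * n * (2 * ξ) / 2 ∧
    ∀ (V : Matrix (Fin n) (Fin r) ℝ) (m : ℝ), 0 ≤ m → (∀ i, euclNorm (V i) ≤ m) →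
      ∀ i, euclNorm ((opB (S - hardThreshold ξ (D + S - M)) * V) i)
        ≤ 2 * (α * n * (2 * ξ)) * m := by
  have hrow : ∀ i, ∑ j, |(S - hardThreshold ξ (D + S - M)) i j| ≤ α * n * (2 * ξ) := fun i =>
    sum_abs_le_of_card (by positivity) (hS.1 i) (fun j hj => sub_hardThreshold_eq_zero (h i j) hj)
      fun j => abs_sub_hardThreshold_le (h i j)
  have hcol : ∀ j, ∑ i, |(S - hardThreshold ξ (D + S - M)) i j| ≤ α * n * (2 * ξ) := fun j =>
    sum_abs_le_of_card (s := fun i => S i j) (by positivity) (hS.2 j)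
      (fun i hi => sub_hardThreshold_eq_zero (h i j) hi) fun i => abs_sub_hardThreshold_le (h i j)
  have ha : 0 ≤ α * n * (2 * ξ) :=
    (Finset.sum_nonneg fun j _ => abs_nonneg _).trans (hrow ⟨0, hn⟩)
  exact ⟨opNorm_opB_le hn (opNorm_le_of_abs_sums ha hrow hcol),
    fun V m hm hV i => euclNorm_row_opB_mul_le hn hrow hm hV i⟩

variable {X : Matrix (Fin n) (Fin r) ℝ} {Ustar : Matrix (Fin n) (Fin r) ℝ} {lamstar : Fin r → ℝ}
  {sr s1 u : ℝ}

lemma IsReference.abs_edm_le (h : IsReference (gram X) Ustar lamstar sr s1 u) (i j : Fin n) :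
    |edm X i j| ≤ 4 * (u * s1) ^ 2 := by
  rw [edm_eq_opA_gram]
  refine abs_opA_le (fun i j => ?_) i j
  rw [← points_mul_transpose h.eig fun j => (h.pos j).le, sq]
  exact (abs_mul_transpose_le _ _ i j).trans (mul_le_mul (h.rows_points i) (h.rows_points j)
    (euclNorm_nonneg _) (mul_nonneg h.u_nonneg h.s1_pos.le))

/-- All iterates stay close to the Gram matrix, with geometrically decreasing accuracy. -/
theorem IsRun.isClose (hn : 0 < n) (h : IsReference (gram X) Ustar lamstar sr s1 u)
    {Sstar : Matrix (Fin n) (Fin n) ℝ} {α ξ0 γ ρ : ℝ} (hsparse : IsSparse α Sstar)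
    (hξ : ∀ i j, |edm X i j| ≤ ξ0) (hγ0 : 0 ≤ γ) (hγ1 : γ ≤ 1)
    (hρ : ρ * sr ^ 2 = α * n * (2 * ξ0)) (hρ0 : 0 ≤ ρ)
    (hsmall : ρ * s1 ^ 2 ≤ 3 / 203 * γ * sr ^ 2) (hentry : 68 * u ^ 2 * s1 ^ 2 * ρ ≤ ξ0 * γ)
    {S L : ℕ → Matrix (Fin n) (Fin n) ℝ} {U : ℕ → Matrix (Fin n) (Fin r) ℝ}
    {lam : ℕ → Fin r → ℝ} (hrun : IsRun r (edm X + Sstar) ξ0 γ S L U lam) (k : ℕ) :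
    IsClose Ustar lamstar sr s1 u (L (k + 1)) (U (k + 1)) (lam (k + 1)) (ρ * γ ^ k) := by
  have hξ0 : 0 ≤ ξ0 := (abs_nonneg _).trans (hξ ⟨0, hn⟩ ⟨0, hn⟩)
  have hs2 := pow_pos h.sr_pos 2
  have hss : sr ^ 2 ≤ s1 ^ 2 := pow_le_pow_left₀ h.sr_pos.le h.sr_le 2
  have hργ : ρ ≤ 3 / 203 * γ := le_of_mul_le_mul_right
    ((mul_le_mul_of_nonneg_left hss hρ0).trans hsmall) hs2
  have hγk : ∀ k, 0 ≤ γ ^ k ∧ γ ^ k ≤ 1 := fun k => ⟨pow_nonneg hγ0 k, pow_le_one₀ hγ0 hγ1⟩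
  have hρk0 : ∀ k, 0 ≤ ρ * γ ^ k := fun k => mul_nonneg hρ0 (hγk k).1
  have hρk1 : ∀ k, ρ * γ ^ k ≤ ρ := fun k => mul_le_of_le_one_right hρ0 (hγk k).2
  have hρk : ∀ k, ρ * γ ^ k ≤ 3 / 203 := fun k => (hρk1 k).trans (by linarith)
  induction k with
  | zero =>
    -- The initial threshold acts on `D` itself, so the entrywise hypothesis is just `‖D⋆‖_∞ ≤ ξ0`.
    have h0 := opB_error_bounds (r := r) (M := 0) hn hsparse hξ0 (by simpa using hξ)
    rw [sub_zero, ← hrun.init_S] at h0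
    have hW : opB (edm X + Sstar - S 0) - gram X = opB (Sstar - S 0) := by
      rw [add_sub_assoc, opB_add, opB_edm hn, add_sub_cancel_left]
    rw [pow_zero, mul_one]
    refine h.isClose_of_rows (hrun.eig 1 le_rfl) hrun.init_L hρ0 (by linarith) ?_ ?_
    · rw [hW, hρ]; exact h0.1
    · intro m hm hU i
      rw [hW, hρ]; exact h0.2 _ m hm hU i
  | succ k ih =>
    have hξk : 0 ≤ ξ0 * γ ^ (k + 1) := mul_nonneg hξ0 (hγk _).1
    -- Entries of the Gram error are at most `17 u² s1² ρ γ^k`, and `𝒜` multiplies this by at most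
    -- `4`; this is where `68` in `hentry` comes from.
    have hent : ∀ i j, |(edm X - opA (L (k + 1))) i j| ≤ ξ0 * γ ^ (k + 1) := fun i j => by
      rw [edm_eq_opA_gram, ← opA_sub]
      refine (abs_opA_le (fun i j => ?_) i j).trans
        (?_ : 4 * (17 * u ^ 2 * s1 ^ 2 * (ρ * γ ^ k)) ≤ _)
      · rw [← neg_sub, Matrix.neg_apply, abs_neg]
        exact ih.abs_sub_le h (hρk0 k) (hρk k) i j
      · have := mul_le_mul_of_nonneg_right hentry (hγk k).1
        rw [pow_succ γ]
        linarith
    have h0 := opB_error_bounds (r := r) hn hsparse hξk hent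
    rw [← hrun.step_S (k + 1) (by omega)] at h0
    have hW : opB (edm X + Sstar - S (k + 1)) = gram X + opB (Sstar - S (k + 1)) := by
      rw [add_sub_assoc, opB_add, opB_edm hn]
    have htop := hrun.step_L (k + 1) (by omega)
    rw [hW] at htop
    have ha : α * n * (2 * (ξ0 * γ ^ (k + 1))) = γ * (ρ * γ ^ k) * sr ^ 2 := by
      rw [pow_succ]; linear_combination (-(γ ^ k * γ)) * hρ
    rw [ha] at h0
    have hb := ih.tangentProj_bounds h (hρk0 k) (γ := γ)
      ((mul_le_mul_of_nonneg_right (hρk1 k) (sq_nonneg s1)).trans hsmall) h0.1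
      (h0.2 _ _ (by have := h.u_nonneg; positivity) ih.rows)
    have heig := hrun.eig (k + 1 + 1) (by omega)
    have e : γ * (ρ * γ ^ k) = ρ * γ ^ (k + 1) := by rw [pow_succ]; ring
    rw [e] at hb
    exact h.isClose heig htop (hρk0 _) (hρk _) hb.1
      (hb.2 _ (opNorm_le_one_of_orthonormal heig.orthonormal))

/-- Two `n × r` factors of the same Gram matrix, one of full column rank, differ by an orthogonal
matrix: take `Q = Λ⁻¹ Pᵀ C`. -/
lemma exists_centered_eq_points_mul {l : Fin r → ℝ} (h : IsEigDecomp (gram X) Ustar l)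
    (hl : ∀ j, 0 < l j) :
    ∃ Q ∈ Matrix.orthogonalGroup (Fin r) ℝ, centered X = points Ustar l * Q := by
  set P := points Ustar l with hP
  set D := Matrix.diagonal fun j => (l j)⁻¹ with hD
  have hPP : P * Pᵀ = gram X := points_mul_transpose h fun j => (hl j).le
  have hPtP : Pᵀ * P = Matrix.diagonal l := transpose_mul_points h fun j => (hl j).le
  have hdd : Matrix.diagonal l * D = 1 := diagonal_mul_diagonal_inv hl
  have hdd' : D * Matrix.diagonal l = 1 := mul_eq_one_comm.1 hdd
  have hDt : Dᵀ = D := Matrix.diagonal_transpose _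
  set C := centered X with hC
  have hCC : C * Cᵀ = P * Pᵀ := hPP.symm
  refine ⟨D * (Pᵀ * C), ?_, ?_⟩
  · refine (Matrix.mem_orthogonalGroup_iff (Fin r) ℝ).2 ?_
    change D * (Pᵀ * C) * (D * (Pᵀ * C))ᵀ = 1
    rw [Matrix.transpose_mul, Matrix.transpose_mul, Matrix.transpose_transpose, hDt]
    calc D * (Pᵀ * C) * (Cᵀ * P * D) = D * Pᵀ * (C * Cᵀ) * P * D := by
          simp only [Matrix.mul_assoc]
      _ = D * (Pᵀ * P) * ((Pᵀ * P) * D) := by rw [hCC]; simp only [Matrix.mul_assoc]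
      _ = 1 := by rw [hPtP, hdd, hdd', Matrix.mul_one]
  -- `K` is the projection off the column space of `P`; it kills `C Cᵀ = P Pᵀ`, hence `C`.
  · set K := 1 - P * D * Pᵀ with hK
    have hKP : K * P = 0 := by
      rw [hK, Matrix.sub_mul, Matrix.one_mul, Matrix.mul_assoc, hPtP, Matrix.mul_assoc, hdd',
        Matrix.mul_one, sub_self]
    have h1 : K * C * (K * C)ᵀ = 0 := by
      rw [Matrix.transpose_mul]
      calc K * C * (Cᵀ * Kᵀ) = K * (C * Cᵀ) * Kᵀ := by simp only [Matrix.mul_assoc]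
        _ = K * P * Pᵀ * Kᵀ := by rw [hCC]; simp only [Matrix.mul_assoc]
        _ = 0 := by rw [hKP]; simp
    have h2 : K * C = 0 := by
      rw [← Matrix.conjTranspose_eq_transpose_of_trivial] at h1
      exact Matrix.self_mul_conjTranspose_eq_zero.1 h1
    rw [hK, Matrix.sub_mul, Matrix.one_mul, sub_eq_zero] at h2
    calc C = _ := h2
      _ = _ := by simp only [Matrix.mul_assoc]

end SparsePart

/-! ### Positivity of the parameters and the final bound -/

lemma IsEigDecomp.pos_of_twoInfNorm_le {n r : ℕ} (hr : 0 < r) {L : Matrix (Fin n) (Fin n) ℝ}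
    {U : Matrix (Fin n) (Fin r) ℝ} {l : Fin r → ℝ} (h : IsEigDecomp L U l) {b : ℝ}
    (hb : twoInfNorm U ≤ Real.sqrt b) : 0 < b := by
  by_contra hneg
  -- `Real.sqrt` is `0` on nonpositive reals, which would force `U = 0` and contradict
  -- orthonormality.
  rw [Real.sqrt_eq_zero_of_nonpos (not_lt.1 hneg)] at hb
  have hU : U = 0 := by
    ext i j
    have h1 := (euclNorm_le_twoInfNorm U i).trans hb
    by_contra hij
    exact (euclNorm_pos (v := U i) fun h0 => hij (congrFun h0 j)).not_ge h1
  have h1 := congrFun (congrFun h.orthonormal ⟨0, hr⟩) ⟨0, hr⟩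
  simp [hU] at h1

lemma IsSparse.nonneg {n : ℕ} (hn : 0 < n) {α : ℝ} {S : Matrix (Fin n) (Fin n) ℝ}
    (h : IsSparse α S) : 0 ≤ α :=
  nonneg_of_mul_nonneg_left ((Nat.cast_nonneg _).trans (h.1 ⟨0, hn⟩)) (by positivity)

end RMDS

theorem proposition1 {n r : ℕ} (hr : 0 < r)
    (X : Matrix (Fin n) (Fin r) ℝ)
    (Ustar : Matrix (Fin n) (Fin r) ℝ) (lamstar : Fin r → ℝ)
    (hL : RMDS.IsEigDecomp (RMDS.gram X) Ustar lamstar)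
    (hpos : ∀ j, 0 < lamstar j)
    (μ : ℝ) (hμ : RMDS.twoInfNorm Ustar ≤ Real.sqrt (μ * r / n))
    (Sstar : Matrix (Fin n) (Fin n) ℝ) (hsymm : Sstar.IsSymm)
    (α : ℝ) (hsparse : RMDS.IsSparse α Sstar)
    (lam1 lamr κ : ℝ) (hlam1 : lam1 = lamstar ⟨0, hr⟩)
    (hlamr : lamr = lamstar ⟨r - 1, Nat.sub_lt hr Nat.one_pos⟩)
    (hκ : κ = lam1 / lamr)
    (ξ0 γ : ℝ) (hξ_lower : RMDS.entryNorm (RMDS.edm X) ≤ ξ0)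
    (hξ_upper : ξ0 ≤ 3 * RMDS.entryNorm (RMDS.edm X))
    (hγ_lower : 1 / 3 ≤ γ) (hγ_upper : γ < 1)
    (hα : α ≤ 1 / 1624 * (γ / (μ * r * κ ^ 2)))
    (S L : ℕ → Matrix (Fin n) (Fin n) ℝ) (U : ℕ → Matrix (Fin n) (Fin r) ℝ)
    (lam : ℕ → Fin r → ℝ)
    (hrun : RMDS.IsRun r (RMDS.edm X + Sstar) ξ0 γ S L U lam) :
    (∀ (k : ℕ) (Y : Matrix (Fin r) (Fin r) ℝ) (σ : Fin r → ℝ) (Z : Matrix (Fin r) (Fin r) ℝ),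
      RMDS.IsSVD ((RMDS.points Ustar lamstar)ᵀ * RMDS.points (U (k + 1)) (lam (k + 1))) Y σ Z →
      RMDS.twoInfNorm
          (RMDS.points (U (k + 1)) (lam (k + 1)) - RMDS.points Ustar lamstar * (Y * Zᵀ))
        ≤ Real.sqrt (μ * r * κ * lam1 / n) * γ ^ (k + 1)) ∧
    ∃ Q ∈ Matrix.orthogonalGroup (Fin r) ℝ,
      RMDS.centered X = RMDS.points Ustar lamstar * Q ∧
      ∀ (k : ℕ) (Y : Matrix (Fin r) (Fin r) ℝ) (σ : Fin r → ℝ) (Z : Matrix (Fin r) (Fin r) ℝ),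
        RMDS.IsSVD ((RMDS.points Ustar lamstar)ᵀ * RMDS.points (U (k + 1)) (lam (k + 1))) Y σ Z →
        RMDS.twoInfNorm
            (RMDS.points (U (k + 1)) (lam (k + 1)) - RMDS.centered X * (Qᵀ * (Y * Zᵀ)))
          ≤ Real.sqrt (μ * r * κ * lam1 / n) * γ ^ (k + 1) := by
  have hn : 0 < n := by
    rcases Nat.eq_zero_or_pos n with rfl | hn
    · have h1 := congrFun (congrFun hL.orthonormal ⟨0, hr⟩) ⟨0, hr⟩
      simp [Matrix.mul_apply] at h1
    · exact hn
  have hn' : (0 : ℝ) < n := by exact_mod_cast hn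
  have hb : 0 < μ * r / n := hL.pos_of_twoInfNorm_le hr hμ
  have hμr : 0 < μ * r := by
    have := mul_pos hb hn'
    rwa [div_mul_cancel₀ _ hn'.ne'] at this
  have hlam1_pos : 0 < lam1 := hlam1 ▸ hpos _
  have hlamr_pos : 0 < lamr := hlamr ▸ hpos _
  have hle : lamr ≤ lam1 := by
    rw [hlam1, hlamr]
    exact hL.descending (Fin.mk_le_mk.2 (Nat.zero_le _))
  have hκ1 : 1 ≤ κ := by rw [hκ, one_le_div hlamr_pos]; exact hle
  have hκl : κ * lamr = lam1 := by rw [hκ, div_mul_cancel₀ _ hlamr_pos.ne']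
  set sr := Real.sqrt lamr with hsr
  set s1 := Real.sqrt lam1 with hs1
  set u := Real.sqrt (μ * r / n) with hu
  have hsr2 : sr ^ 2 = lamr := Real.sq_sqrt hlamr_pos.le
  have hs12 : s1 ^ 2 = lam1 := Real.sq_sqrt hlam1_pos.le
  have hu2 : u ^ 2 * n = μ * r := by
    rw [hu, Real.sq_sqrt hb.le, div_mul_cancel₀ _ hn'.ne']
  have hs1_pos : 0 < s1 := Real.sqrt_pos.2 hlam1_pos
  have href : RMDS.IsReference (RMDS.gram X) Ustar lamstar sr s1 u :=
    { eig := hL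
      sr_pos := Real.sqrt_pos.2 hlamr_pos
      sr_le := Real.sqrt_le_sqrt hle
      lower := fun j => by
        rw [hsr2, hlamr]
        exact hL.descending (by rw [Fin.le_def]; have := j.isLt; simp only; omega)
      upper := fun j => by
        rw [hs12, hlam1]
        exact hL.descending (by rw [Fin.le_def]; simp)
      u_nonneg := Real.sqrt_nonneg _
      rows := fun i => (RMDS.euclNorm_le_twoInfNorm Ustar i).trans hμ }
  have hu0 : 0 ≤ u := href.u_nonneg
  have hne : Nonempty (Fin n × Fin n) := ⟨(⟨0, hn⟩, ⟨0, hn⟩)⟩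
  have hξ : ∀ i j, |RMDS.edm X i j| ≤ ξ0 := fun i j =>
    (le_ciSup (f := fun p : Fin n × Fin n => |RMDS.edm X p.1 p.2|)
      (Set.finite_range _).bddAbove (i, j)).trans hξ_lower
  have hξ0 : 0 ≤ ξ0 := (abs_nonneg _).trans (hξ ⟨0, hn⟩ ⟨0, hn⟩)
  -- `12 = 3 · 4`: the factor allowed in `ξ0` times the factor lost by `𝒜`.
  have hξu : ξ0 ≤ 12 * (u * s1) ^ 2 := by
    have : RMDS.entryNorm (RMDS.edm X) ≤ 4 * (u * s1) ^ 2 :=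
      ciSup_le fun p => href.abs_edm_le p.1 p.2
    linarith
  have hα0 : 0 ≤ α := hsparse.nonneg hn
  have hγ0 : 0 ≤ γ := by linarith
  have hακ : 1624 * (α * (μ * r) * κ ^ 2) ≤ γ := by
    have h1 : 0 < μ * r * κ ^ 2 := by positivity
    have h2 := mul_le_mul_of_nonneg_right hα h1.le
    have h3 : 1 / 1624 * (γ / (μ * r * κ ^ 2)) * (μ * r * κ ^ 2) = 1 / 1624 * γ := by
      rw [mul_assoc, div_mul_cancel₀ _ h1.ne']
    linarith
  have hακ1 : 1624 * (α * (μ * r) * κ) ≤ γ := by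
    have h1 : 0 ≤ α * (μ * r) := mul_nonneg hα0 hμr.le
    have h2 : κ ≤ κ ^ 2 := by nlinarith
    linarith [mul_le_mul_of_nonneg_left h2 h1]
  -- The absolute row sum bound for the first thresholding error, relative to `λ_r`.
  set ρ := α * n * (2 * ξ0) / sr ^ 2 with hρdef
  have hρ : ρ * sr ^ 2 = α * n * (2 * ξ0) := div_mul_cancel₀ _ (by rw [hsr2]; exact hlamr_pos.ne')
  have hρ0 : 0 ≤ ρ := by positivity
  have hρκ : ρ * s1 ^ 2 = α * n * (2 * ξ0) * κ := by
    rw [hs12, ← hκl, ← hρ, hsr2]; ring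
  -- This needs `κ²`: one factor from `s1² / sr²` and one from `ξ0 ≲ u² λ_1`. The constant is `24 /
  -- 1624 = 3 / 203`.
  have hsmall : ρ * s1 ^ 2 ≤ 3 / 203 * γ * sr ^ 2 := by
    rw [hρκ, hsr2]
    have h1 : 0 ≤ α * n * κ * 2 := by positivity
    have h2 := mul_le_mul_of_nonneg_left hξu h1
    have h3 := mul_le_mul_of_nonneg_right hακ hlamr_pos.le
    have h4 : α * n * κ * 2 * (12 * (u * s1) ^ 2) = 24 * (α * (μ * r) * κ ^ 2) * lamr := by
      rw [mul_pow, hs12, ← hκl, ← hu2]; ring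
    linarith
  have hentry : 68 * u ^ 2 * s1 ^ 2 * ρ ≤ ξ0 * γ := by
    have h1 : 68 * u ^ 2 * s1 ^ 2 * ρ = 136 * (α * (μ * r) * κ) * ξ0 := by
      calc _ = 68 * u ^ 2 * (ρ * s1 ^ 2) := by ring
        _ = _ := by rw [hρκ, ← hu2]; ring
    rw [h1]
    have h2 : 0 ≤ α * (μ * r) * κ := by positivity
    nlinarith [mul_le_mul_of_nonneg_right hακ1 hξ0]
  have hργ : ρ ≤ 3 / 203 * γ := by
    have h1 := mul_le_mul_of_nonneg_left (pow_le_pow_left₀ href.sr_pos.le href.sr_le 2) hρ0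
    exact le_of_mul_le_mul_right (h1.trans hsmall) (pow_pos href.sr_pos 2)
  have hsqrt : u * s1 ≤ Real.sqrt (μ * r * κ * lam1 / n) := by
    rw [hu, hs1, ← Real.sqrt_mul hb.le]
    refine Real.sqrt_le_sqrt ?_
    have h1 : μ * r * κ * lam1 / n = μ * r / n * lam1 * κ := by ring
    rw [h1]
    exact le_mul_of_one_le_right (by positivity) hκ1
  have hmain : ∀ (k : ℕ) (Y : Matrix (Fin r) (Fin r) ℝ) (σ : Fin r → ℝ)
      (Z : Matrix (Fin r) (Fin r) ℝ),
      RMDS.IsSVD ((RMDS.points Ustar lamstar)ᵀ * RMDS.points (U (k + 1)) (lam (k + 1))) Y σ Z →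
      RMDS.twoInfNorm
          (RMDS.points (U (k + 1)) (lam (k + 1)) - RMDS.points Ustar lamstar * (Y * Zᵀ))
        ≤ Real.sqrt (μ * r * κ * lam1 / n) * γ ^ (k + 1) := fun k Y σ Z hsvd => by
    have hcl := hrun.isClose hn href hsparse hξ hγ0 hγ_upper.le hρ hρ0 hsmall hentry k
    refine RMDS.twoInfNorm_le (by positivity) fun i => (hcl.rows_sub Y σ Z hsvd i).trans ?_
    -- `8 · 3/203 < 1`, which supplies the extra factor `γ` in `γ ^ (k + 1)`.
    have h1 : 8 * ρ ≤ γ := by linarith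
    calc 8 * u * s1 * (ρ * γ ^ k) = u * s1 * (8 * ρ) * γ ^ k := by ring
      _ ≤ Real.sqrt (μ * r * κ * lam1 / n) * γ * γ ^ k := by gcongr
      _ = _ := by rw [pow_succ]; ring
  obtain ⟨Q, hQ, hXQ⟩ := RMDS.exists_centered_eq_points_mul hL hpos
  refine ⟨hmain, Q, hQ, hXQ, fun k Y σ Z hsvd => ?_⟩
  have hQQ : Q * Qᵀ = 1 := (Matrix.mem_orthogonalGroup_iff (Fin r) ℝ).1 hQ
  have hrot : RMDS.centered X * (Qᵀ * (Y * Zᵀ)) = RMDS.points Ustar lamstar * (Y * Zᵀ) := by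
    rw [hXQ, Matrix.mul_assoc, ← Matrix.mul_assoc Q, hQQ, Matrix.one_mul]
  rw [hrot]
  exact hmain k Y σ Z hsvd
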